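/- For $n\ge 0$ let $T_n=n(n+1)/2$ and $G_n=T_n-T_{\lfloor n/2\rfloor}$ (the generalized pentagonal numbers $0,1,2,5,7,12,15,\dots$). Let $Q(n)$ be the number of partitions of $n$ into distinct parts, with $Q(0)=1$ and $Q(n)=0$ for $n<0$. For $r\in\{2,3\}$ let $Q_r(n)$ be the number of partitions of $n$ into distinct parts none of which is divisible by $r$. Let $\delta_{i,j}$ be the Kronecker delta. The $2$-modular graph of a partition into odd parts represents each part $2a+1$ by a left-justified row of $a+1$ cells, filled with $1,2,2,\dots,2$ ($a$ twos), the rows being arranged in weakly decreasing order of length from top to bottom. For $k\ge 1$ its $(k+2)$-Durfee rectangle is the largest rectangle with $d$ rows and $d+k+2$ columns ($d\ge 0$) that fits into its top left corner; its width is $d+k+2$. Let $M_{o,k}(n)$ be the number of partitions of $n$ into odd parts such that each of $1,3,5,\dots,2k+1$ occurs as a part at least once and every row of the $2$-modular graph below the $(k+2)$-Durfee rectangle has length strictly less than the width of the rectangle. Let $m,n\ge 0$ and $k\ge 1$ be integers, and assume that $n=G_m$ in case $n$ is a generalized pentagonal number (if $n$ is not a generalized pentagonal number, $m$ is arbitrary).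 Then a) $\displaystyle (-1)^{k}\Big( Q(n)+2 \sum_{j=1}^{k} (-1)^j Q(n-j^2)-(-1)^{T_m} \delta_{n,G_m}\Big) = 2M_{o,k}(n)$; b) $\displaystyle (-1)^{k}\Big( Q(n)+2 \sum_{j=1}^{k} (-1)^j Q(n-2j^2)-(-1)^{T_{\lfloor m/2 \rfloor}}\delta_{n,G_m}\Big) = 2\sum_{j=0}^{\lfloor n/2 \rfloor} M_{o,k}(j)\, Q_{2}(n-2j)$; c) $\displaystyle (-1)^{k}\Big( Q(n)+2 \sum_{j=1}^{k} (-1)^j Q(n-3j^2)-\delta_{n,G_m}\Big) = 2\sum_{j=0}^{\lfloor n/3 \rfloor} M_{o,k}(j)\, Q_{3}(n-3j)$. -/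

import Mathlib

namespace TruncTheta

/-- The `n`th triangular number `n (n + 1) / 2` (an exact division). -/
def T (n : ℕ) : ℕ := n * (n + 1) / 2

/-- The `n`th generalized pentagonal number `T n - T ⌊n / 2⌋` (never truncated, as `T` is
monotone): `0, 1, 2, 5, 7, 12, 15, …`. -/
def G (n : ℕ) : ℕ := T n - T (n / 2)

/-- The number of partitions of the integer `n` into distinct parts; it is `1` at `n = 0` and
`0` for negative `n`. -/
def Q (n : ℤ) : ℕ :=
  if 0 ≤ n then (Nat.Partition.distincts n.toNat).card else 0

/-- The number of partitions of `n` into distinct parts, none of which is divisible by `r`. -/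
def Qr (r n : ℕ) : ℕ :=
  ((Nat.Partition.distincts n).filter (fun p => ∀ i ∈ p.parts, ¬ r ∣ i)).card

/-- The row of the 2-modular graph that represents a part: the part `2 a + 1` is the row
`1, 2, 2, …, 2` with `a` twos, and the part `2 a` is the row `2, 2, …, 2` with `a` twos. -/
def twoModularRow (i : ℕ) : List ℕ :=
  (if i % 2 = 1 then [1] else []) ++ List.replicate (i / 2) 2

/-- The 2-modular graph of a partition, as the list of its rows from the top (largest part) to
the bottom (smallest part). -/
def twoModularGraph {n : ℕ} (p : n.Partition) : List (List ℕ) :=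
  (p.parts.sort (· ≥ ·)).map twoModularRow

/-- A rectangle with `h` rows and `w` columns, placed in the top left corner, is contained in the
graph `g`. -/
def ContainsRectangle (g : List (List ℕ)) (h w : ℕ) : Prop :=
  h ≤ g.length ∧ ∀ row ∈ g.take h, w ≤ row.length

instance (g : List (List ℕ)) (h w : ℕ) : Decidable (ContainsRectangle g h w) :=
  inferInstanceAs (Decidable (h ≤ g.length ∧ ∀ row ∈ g.take h, w ≤ row.length))

/-- The height of the `m`-Durfee rectangle of `g`: the largest `d` such that `g` contains a
rectangle with `d` rows and `d + m` columns. Height `0` is allowed. -/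
def durfeeHeight (m : ℕ) (g : List (List ℕ)) : ℕ :=
  Nat.findGreatest (fun d => ContainsRectangle g d (d + m)) g.length

/-- The width of the `m`-Durfee rectangle of `g`. -/
def durfeeWidth (m : ℕ) (g : List (List ℕ)) : ℕ := durfeeHeight m g + m

/-- The rows of `g` that lie below its `m`-Durfee rectangle. -/
def rowsBelowDurfee (m : ℕ) (g : List (List ℕ)) : List (List ℕ) := g.drop (durfeeHeight m g)

/-- The number of partitions of `n` into odd parts such that every odd number up to `2 k + 1`
occurs as a part, and the parts below the `(k + 2)`-Durfee rectangle in the 2-modular graph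
(that is, the lengths of the rows below it) are strictly less than the width of the rectangle. -/
def Mo (k n : ℕ) : ℕ :=
  ((Nat.Partition.odds n).filter (fun p =>
    (∀ i ∈ Finset.range (2 * k + 2), Odd i → i ∈ p.parts) ∧
    ∀ row ∈ rowsBelowDurfee (k + 2) (twoModularGraph p),
      row.length < durfeeWidth (k + 2) (twoModularGraph p))).card

end TruncTheta

/-! The proof rests on a recurrence in `k` and on a limit as `k` grows.

Recurrence (`Mo_add_Mo_succ`): `Mo k n + Mo (k + 1) n = Q (n - (k + 1) ^ 2)`. Removing one copy of
each of `1, 3, …, 2k + 1` and applying Euler's odd/distinct theorem, the right side counts all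
partitions of `n` into odd parts that contain these numbers. The Durfee condition says that for some
`d` exactly `d` parts are at least `2d + c`, where `c = 2k + 3`. If it fails, some part `2d + c`
sits where the count jumps past the diagonal; deleting it, adding `2` to each of `d` large parts and
inserting `c` preserves the sum and gives a partition counted by `Mo (k + 1) n`.

Limit: distinct parts split into those divisible by `r` and the rest, so `distinctSeries 0` is
`distinctSeries r` times its own image under `X ↦ X ^ r`. Gauss's identity in `X ^ r` then turns
`distinctSeries 0` times the full theta series into `distinctSeries r * ∏ (1 - X ^ (r i))`. For `r =
1, 2, 3` the triple product evaluates this as a theta series with `a = ±X`, `b = ±X ^ 2`, whose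
exponents are the generalized pentagonal numbers; this is the Kronecker delta term.

By the recurrence, the difference of the two sides only changes sign when `k` increases by one; it
vanishes for `k > n`, hence always. Infinite products are handled modulo `X ^ N`, where `X` is
nilpotent and finite products suffice. -/

open Finset

namespace TruncTheta

/-! ### Gaussian binomial coefficients over a commutative ring. -/

section GaussBinom

variable {R : Type*} [CommRing R]

/-- The Gaussian binomial coefficient, as an element of a ring with a chosen `q`. -/
def gaussBinom (q : R) : ℕ → ℕ → R
  | _, 0 => 1
  | 0, _ + 1 => 0
  | n + 1, k + 1 => gaussBinom q n k + q ^ (k + 1) * gaussBinom q n (k + 1)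

@[simp] lemma gaussBinom_zero_right (q : R) (n : ℕ) : gaussBinom q n 0 = 1 := by
  cases n <;> rfl

@[simp] lemma gaussBinom_zero_succ (q : R) (k : ℕ) : gaussBinom q 0 (k + 1) = 0 := rfl

lemma gaussBinom_succ_succ (q : R) (n k : ℕ) :
    gaussBinom q (n + 1) (k + 1) = gaussBinom q n k + q ^ (k + 1) * gaussBinom q n (k + 1) := rfl

lemma gaussBinom_eq_zero_of_lt (q : R) {n k : ℕ} (h : n < k) : gaussBinom q n k = 0 := by
  induction n generalizing k with
  | zero => obtain ⟨k, rfl⟩ := Nat.exists_eq_add_one_of_ne_zero h.ne'; rfl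
  | succ n ih =>
    obtain ⟨k, rfl⟩ := Nat.exists_eq_add_one_of_ne_zero (Nat.ne_zero_of_lt h)
    rw [gaussBinom_succ_succ, ih (by omega), ih (by omega)]; simp

/-- The second q-Pascal rule. In the finite triple product it absorbs a new factor on the `a` side,
while the defining rule absorbs one on the `b` side. For `n < k` the truncated exponent is harmless,
since its coefficient vanishes. -/
lemma gaussBinom_succ_succ' (q : R) (n k : ℕ) :
    gaussBinom q (n + 1) (k + 1) = q ^ (n - k) * gaussBinom q n k + gaussBinom q n (k + 1) := by
  induction n generalizing k with
  | zero => cases k <;> simp [gaussBinom_succ_succ]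
  | succ n ih =>
    rw [gaussBinom_succ_succ]
    cases k with
    | zero =>
      have h := ih 0
      rw [gaussBinom_succ_succ] at h
      simp only [gaussBinom_zero_right, gaussBinom_succ_succ, Nat.sub_zero, zero_add, pow_one,
        mul_one] at h ⊢
      linear_combination q * h
    | succ k =>
      rcases lt_or_ge n (k + 1) with hn | hn
      · have h1 := gaussBinom_eq_zero_of_lt q hn
        have h2 := gaussBinom_eq_zero_of_lt q (show n < k + 1 + 1 by omega)
        have h3 : gaussBinom q (n + 1) (k + 1 + 1) = 0 := by
          rw [gaussBinom_succ_succ, h1, h2]; simp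
        rw [h3]
        rcases lt_or_ge n k with hk | hk
        · rw [gaussBinom_eq_zero_of_lt q (show n + 1 < k + 1 by omega)]; simp
        · rw [show n + 1 - (k + 1) = 0 by omega]; simp
      · obtain ⟨l, rfl⟩ := Nat.exists_eq_add_of_le hn
        have e1 := ih k
        have e2 := ih (k + 1)
        rw [show k + 1 + l - k = l + 1 by omega] at e1
        rw [show k + 1 + l - (k + 1) = l by omega] at e2
        rw [show k + 1 + l + 1 - (k + 1) = l + 1 by omega]
        rw [e1, e2]
        have f1 := gaussBinom_succ_succ q (k + 1 + l) k
        have f2 := gaussBinom_succ_succ q (k + 1 + l) (k + 1)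
        rw [e1] at f1
        rw [e2] at f2
        linear_combination -q ^ (l + 1) * f1 - f2

lemma gaussBinom_symm (q : R) (k l : ℕ) : gaussBinom q (k + l) k = gaussBinom q (k + l) l := by
  induction h : k + l generalizing k l with
  | zero =>
    obtain ⟨rfl, rfl⟩ : k = 0 ∧ l = 0 := by omega
    rfl
  | succ n ih =>
    rcases k with _ | k <;> rcases l with _ | l
    · rfl
    · obtain rfl : l = n := by omega
      have := ih 0 l (by omega)
      rw [gaussBinom_succ_succ, ← this, gaussBinom_eq_zero_of_lt q (Nat.lt_succ_self l)]; simp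
    · obtain rfl : k = n := by omega
      have := ih k 0 (by omega)
      rw [gaussBinom_succ_succ, this, gaussBinom_eq_zero_of_lt q (Nat.lt_succ_self k)]; simp
    · rw [gaussBinom_succ_succ, gaussBinom_succ_succ', ih k (l + 1) (by omega),
        ih (k + 1) l (by omega), show n - l = k + 1 by omega]
      ring

/-- The quotient formula without division, as `1 - q ^ i` need not be invertible in `R`. For `k > n`
both sides vanish, the right one through its factor `1 - q ^ 0`. -/
lemma gaussBinom_mul_prod (q : R) (n k : ℕ) :
    gaussBinom q n k * ∏ i ∈ range k, (1 - q ^ (i + 1)) = ∏ i ∈ range k, (1 - q ^ (n - i)) := by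
  induction n generalizing k with
  | zero =>
    cases k with
    | zero => simp
    | succ k => simp [Finset.prod_range_succ]
  | succ n ih =>
    cases k with
    | zero => simp
    | succ k =>
      have h1 := ih k
      have h2 := ih (k + 1)
      rw [prod_range_succ _ k, prod_range_succ _ k] at h2
      rw [gaussBinom_succ_succ, prod_range_succ, prod_range_succ' (fun i => 1 - q ^ (n + 1 - i))]
      simp only [Nat.add_sub_add_right, Nat.sub_zero]
      rcases lt_or_ge n k with hk | hk
      · have h0 : ∏ i ∈ range k, (1 - q ^ (n - i)) = 0 :=
          Finset.prod_eq_zero (i := n) (by simpa using hk) (by simp)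
        rw [h0] at h1 h2 ⊢
        linear_combination (1 - q ^ (k + 1)) * h1 + q ^ (k + 1) * h2
      · obtain ⟨l, rfl⟩ := Nat.exists_eq_add_of_le hk
        rw [Nat.add_sub_cancel_left] at h2
        linear_combination (1 - q ^ (k + 1)) * h1 + q ^ (k + 1) * h2

end GaussBinom

/-! ### The Jacobi triple product, finite and modulo a nilpotent. -/

section TripleProduct

variable {R : Type*} [CommRing R]

/-- The triangular number `j (j + 1) / 2` of an integer. -/
def triangle (j : ℤ) : ℕ := (j * (j + 1) / 2).toNat

lemma two_mul_triangle (j : ℤ) : 2 * (triangle j : ℤ) = j * (j + 1) := by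
  have h : 0 ≤ j * (j + 1) := by
    rcases le_or_gt 0 j with h | h
    · positivity
    · exact mul_nonneg_of_nonpos_of_nonpos h.le (by omega)
  rw [triangle, Int.toNat_of_nonneg (by omega)]
  exact Int.mul_ediv_cancel' (Int.even_mul_succ_self j).two_dvd

/-- The general term of Ramanujan's theta function `f(a, b)`. -/
def thetaTerm (a b : R) (j : ℤ) : R := a ^ triangle j * b ^ triangle (-j)

/-- Formally the ratio of consecutive terms is `a * (a * b) ^ j`; since `j` may be negative, powers
of `a * b` are multiplied across instead. -/
lemma pow_mul_thetaTerm_add_one (a b : R) {m e : ℕ} {j : ℤ} (h : (e : ℤ) = m - j) :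
    (a * b) ^ e * thetaTerm a b (j + 1) = a * (a * b) ^ m * thetaTerm a b j := by
  have h1 := two_mul_triangle j
  have h2 := two_mul_triangle (j + 1)
  have h3 := two_mul_triangle (-j)
  have h4 := two_mul_triangle (-(j + 1))
  have e1 : e + triangle (j + 1) = m + 1 + triangle j := by zify; linarith
  have e2 : e + triangle (-(j + 1)) = m + triangle (-j) := by zify; linarith
  simp only [thetaTerm, mul_pow]
  calc a ^ e * b ^ e * (a ^ triangle (j + 1) * b ^ triangle (-(j + 1)))
      = a ^ (e + triangle (j + 1)) * b ^ (e + triangle (-(j + 1))) := by ring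
    _ = _ := by rw [e1, e2]; ring

lemma pow_mul_thetaTerm_sub_one (a b : R) {n k : ℕ} {j : ℤ} (h : (k : ℤ) = n + j) :
    (a * b) ^ k * thetaTerm a b (j - 1) = b * (a * b) ^ n * thetaTerm a b j := by
  have h1 := two_mul_triangle j
  have h2 := two_mul_triangle (j - 1)
  have h3 := two_mul_triangle (-j)
  have h4 := two_mul_triangle (-(j - 1))
  have e1 : k + triangle (j - 1) = n + triangle j := by zify; linarith
  have e2 : k + triangle (-(j - 1)) = n + 1 + triangle (-j) := by zify; linarith
  simp only [thetaTerm, mul_pow]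
  calc a ^ k * b ^ k * (a ^ triangle (j - 1) * b ^ triangle (-(j - 1)))
      = a ^ (k + triangle (j - 1)) * b ^ (k + triangle (-(j - 1))) := by ring
    _ = _ := by rw [e1, e2]; ring

/-- The finite form of the Jacobi triple product identity. -/
theorem prod_mul_prod_eq_sum_gaussBinom (a b : R) (m n : ℕ) :
    (∏ i ∈ range m, (1 + a * (a * b) ^ i)) * ∏ i ∈ range n, (1 + b * (a * b) ^ i) =
      ∑ k ∈ range (m + n + 1), gaussBinom (a * b) (m + n) k * thetaTerm a b ((k : ℤ) - n) := by
  induction n with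
  | zero =>
    induction m with
    | zero => simp [thetaTerm, triangle]
    | succ m ih =>
      simp only [range_zero, prod_empty, mul_one, add_zero, Nat.cast_zero, sub_zero] at ih ⊢
      rw [prod_range_succ, ih, sum_range_succ' _ (m + 1)]
      have h1 : ∑ k ∈ range (m + 1), gaussBinom (a * b) m k * thetaTerm a b k =
          ∑ k ∈ range (m + 1), gaussBinom (a * b) m (k + 1) * thetaTerm a b (k + 1 : ℕ)
            + gaussBinom (a * b) (m + 1) 0 * thetaTerm a b (0 : ℕ) := by
        have := sum_range_succ' (fun k => gaussBinom (a * b) m k * thetaTerm a b k) (m + 1)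
        rw [sum_range_succ, gaussBinom_eq_zero_of_lt _ (Nat.lt_succ_self m)] at this
        simpa using this
      have h2 : ∀ k ∈ range (m + 1),
          gaussBinom (a * b) (m + 1) (k + 1) * thetaTerm a b (k + 1 : ℕ) =
          gaussBinom (a * b) m k * thetaTerm a b k * (a * (a * b) ^ m) +
            gaussBinom (a * b) m (k + 1) * thetaTerm a b (k + 1 : ℕ) := by
        intro k hk
        rw [mem_range] at hk
        have := pow_mul_thetaTerm_add_one a b (m := m) (e := m - k) (j := k) (by omega)
        rw [gaussBinom_succ_succ']
        push_cast
        linear_combination gaussBinom (a * b) m k * this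
      rw [sum_congr rfl h2, sum_add_distrib, ← sum_mul]
      linear_combination h1
  | succ n ih =>
    rw [prod_range_succ, ← mul_assoc, ih, ← add_assoc, sum_range_succ' _ (m + n + 1)]
    have h1 : ∑ k ∈ range (m + n + 1), gaussBinom (a * b) (m + n) k *
        (thetaTerm a b ((k : ℤ) - n) * (b * (a * b) ^ n)) =
        ∑ k ∈ range (m + n + 1), (a * b) ^ (k + 1) * gaussBinom (a * b) (m + n) (k + 1) *
            thetaTerm a b (((k + 1 : ℕ) : ℤ) - (n + 1 : ℕ))
          + gaussBinom (a * b) (m + n + 1) 0 * thetaTerm a b (((0 : ℕ) : ℤ) - (n + 1 : ℕ)) := by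
      have := sum_range_succ' (fun k => (a * b) ^ k * gaussBinom (a * b) (m + n) k *
        thetaTerm a b ((k : ℤ) - (n + 1 : ℕ))) (m + n + 1)
      rw [sum_range_succ, gaussBinom_eq_zero_of_lt _ (Nat.lt_succ_self (m + n))] at this
      simp only [mul_zero, zero_mul, add_zero, pow_zero, one_mul, gaussBinom_zero_right] at this
      rw [gaussBinom_zero_right, one_mul, ← this]
      refine sum_congr rfl fun k _ => ?_
      have := pow_mul_thetaTerm_sub_one a b (n := n) (k := k) (j := (k : ℤ) - n) (by ring)
      rw [sub_sub] at this
      push_cast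
      linear_combination -gaussBinom (a * b) (m + n) k * this
    have h2 : ∀ k ∈ range (m + n + 1), gaussBinom (a * b) (m + n + 1) (k + 1) *
        thetaTerm a b (((k + 1 : ℕ) : ℤ) - (n + 1 : ℕ)) =
        gaussBinom (a * b) (m + n) k * thetaTerm a b ((k : ℤ) - n) +
        (a * b) ^ (k + 1) * gaussBinom (a * b) (m + n) (k + 1) *
            thetaTerm a b (((k + 1 : ℕ) : ℤ) - (n + 1 : ℕ)) := by
      intro k _
      rw [gaussBinom_succ_succ, show (((k + 1 : ℕ) : ℤ) - (n + 1 : ℕ)) = (k : ℤ) - n by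
        push_cast; ring]
      ring
    rw [sum_congr rfl h2, sum_add_distrib]
    have h3 : (∑ k ∈ range (m + n + 1), gaussBinom (a * b) (m + n) k *
        thetaTerm a b ((k : ℤ) - n)) * (b * (a * b) ^ n) =
        ∑ k ∈ range (m + n + 1), gaussBinom (a * b) (m + n) k *
        (thetaTerm a b ((k : ℤ) - n) * (b * (a * b) ^ n)) := by
      rw [sum_mul]; simp only [mul_assoc]
    linear_combination h3 + h1

lemma pow_dvd_prod_one_sub_sub_one {ι : Type*} (s : Finset ι) (q : R) (e : ι → ℕ) (c : ℕ)
    (h : ∀ i ∈ s, c ≤ e i) : q ^ c ∣ (∏ i ∈ s, (1 - q ^ e i)) - 1 := by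
  induction s using Finset.cons_induction with
  | empty => simp
  | cons i s hi ih =>
    rw [prod_cons]
    have h1 := ih fun j hj => h j (mem_cons_of_mem hj)
    have h2 : q ^ c ∣ q ^ e i := pow_dvd_pow _ (h i (mem_cons_self ..))
    have : (1 - q ^ e i) * ∏ j ∈ s, (1 - q ^ e j) - 1 =
      ((∏ j ∈ s, (1 - q ^ e j)) - 1) - q ^ e i * ∏ j ∈ s, (1 - q ^ e j) := by ring
    rw [this]
    exact dvd_sub h1 (h2.mul_right _)

/-- After cancelling the first `k` factors, only factors `1 - q ^ e` with `e ≥ k + 1` remain. -/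
lemma pow_dvd_gaussBinom_mul_prod_sub_one (q : R) {n k : ℕ} (hk : k ≤ n) :
    q ^ (k + 1) ∣ gaussBinom q (2 * n) k * ∏ i ∈ range n, (1 - q ^ (i + 1)) - 1 := by
  rw [← prod_range_mul_prod_Ico _ hk, ← mul_assoc, gaussBinom_mul_prod]
  have h1 := pow_dvd_prod_one_sub_sub_one (range k) q (fun i => 2 * n - i) (k + 1)
    (fun i hi => by rw [mem_range] at hi; omega)
  have h2 := pow_dvd_prod_one_sub_sub_one (Ico k n) q (fun i => i + 1) (k + 1)
    (fun i hi => by rw [mem_Ico] at hi; omega)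
  have := dvd_add (h1.mul_right (∏ i ∈ Ico k n, (1 - q ^ (i + 1)))) h2
  convert this using 1
  ring

/-- The Jacobi triple product identity, modulo the `N`-th power of a common divisor of `a`, `b`. -/
theorem tripleProduct_of_pow_eq_zero {x a b : R} {N n : ℕ} (hx : x ^ N = 0) (ha : x ∣ a)
    (hb : x ∣ b) (hn : N ≤ n) :
    (∏ i ∈ range n, (1 + a * (a * b) ^ i)) * (∏ i ∈ range n, (1 + b * (a * b) ^ i)) *
      ∏ i ∈ range n, (1 - (a * b) ^ (i + 1)) =
    ∑ k ∈ range (2 * n + 1), thetaTerm a b ((k : ℤ) - n) := by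
  rw [prod_mul_prod_eq_sum_gaussBinom, sum_mul, ← two_mul]
  refine sum_congr rfl fun k hk => ?_
  rw [mem_range] at hk
  have hq : x ∣ a * b := ha.mul_right b
  have key : ∀ l, l ≤ n → (l : ℤ) = n - |(k : ℤ) - n| → gaussBinom (a * b) (2 * n) k =
      gaussBinom (a * b) (2 * n) l →
      gaussBinom (a * b) (2 * n) k * thetaTerm a b ((k : ℤ) - n) *
        ∏ i ∈ range n, (1 - (a * b) ^ (i + 1)) = thetaTerm a b ((k : ℤ) - n) := by
    intro l hl hkl hg
    rw [hg, ← sub_eq_zero]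
    have h1 := (pow_dvd_pow_of_dvd hq (l + 1)).trans
      (pow_dvd_gaussBinom_mul_prod_sub_one (a * b) hl)
    set j := (k : ℤ) - n
    have h2 : x ^ (triangle j + triangle (-j)) ∣ thetaTerm a b j := by
      rw [pow_add]
      exact mul_dvd_mul (pow_dvd_pow_of_dvd ha _) (pow_dvd_pow_of_dvd hb _)
    -- The theta term supplies `x ^ (j ^ 2)` because the two triangular numbers add up to `j ^ 2`,
    -- and `l = n - |j|`; as `|j| ≤ j ^ 2`, the total is at least `n + 1 > N`.
    have h3 : N ≤ l + 1 + (triangle j + triangle (-j)) := by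
      have e1 := two_mul_triangle j
      have e2 := two_mul_triangle (-j)
      have e3 : |j| ≤ j ^ 2 := by
        rw [← sq_abs]
        rcases (abs_nonneg j).eq_or_lt with h | h
        · rw [← h]; norm_num
        · nlinarith
      zify
      nlinarith
    have h4 := mul_dvd_mul h1 h2
    rw [← pow_add] at h4
    have h5 := (pow_dvd_pow x h3).trans h4
    rw [hx, zero_dvd_iff] at h5
    linear_combination h5
  rcases le_or_gt k n with h | h
  · exact key k h (by rw [abs_of_nonpos (by omega)]; ring) rfl
  · refine key (2 * n - k) (by omega) (by rw [abs_of_nonneg (by omega)]; omega) ?_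
    have := gaussBinom_symm (a * b) k (2 * n - k)
    rwa [show k + (2 * n - k) = 2 * n by omega] at this

end TripleProduct

end TruncTheta

namespace TruncTheta

/-! ### The Durfee rectangle condition as a count of large parts. -/

section Durfee

lemma containsRectangle_iff_le_countP {g : List (List ℕ)}
    (hg : g.Pairwise fun a b => b.length ≤ a.length) (h w : ℕ) :
    ContainsRectangle g h w ↔ h ≤ g.countP (w ≤ ·.length) := by
  unfold ContainsRectangle
  induction g generalizing h with
  | nil => simp +contextual
  | cons a g ih =>
    rw [List.pairwise_cons] at hg
    cases h with
    | zero => simp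
    | succ h =>
      by_cases ha : w ≤ a.length
      · rw [List.countP_cons_of_pos (by simpa using ha)]
        have := ih hg.2 h
        simp only [List.take_succ_cons, List.length_cons, List.forall_mem_cons] at this ⊢
        grind
      · rw [List.countP_cons_of_neg (by simpa using ha)]
        have h0 : g.countP (w ≤ ·.length) = 0 := by
          rw [List.countP_eq_zero]
          intro b hb
          have := hg.1 b hb
          simp only [decide_eq_true_eq]
          omega
        simp [h0, ha]

/-- A `d × (d + m)` rectangle fits iff at least `d` rows have length `≥ d + m`, and no such row lies
below it iff there are exactly `d`. Such a `d` must be the Durfee height, because the count does not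
increase with the width. -/
lemma forall_rowsBelowDurfee_iff {g : List (List ℕ)}
    (hg : g.Pairwise fun a b => b.length ≤ a.length) (m : ℕ) :
    (∀ row ∈ rowsBelowDurfee m g, row.length < durfeeWidth m g) ↔
      ∃ d, g.countP (d + m ≤ ·.length) = d := by
  have hdrop : ∀ d, ContainsRectangle g d (d + m) →
      ((∀ row ∈ g.drop d, row.length < d + m) ↔ g.countP (d + m ≤ ·.length) = d) := by
    intro d hd
    have h1 : g.countP (d + m ≤ ·.length) =
        (g.take d).countP (d + m ≤ ·.length) + (g.drop d).countP (d + m ≤ ·.length) := by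
      rw [← List.countP_append, List.take_append_drop]
    have h2 : (g.take d).countP (d + m ≤ ·.length) = d := by
      rw [List.countP_eq_length.2 (by simpa using hd.2), List.length_take_of_le hd.1]
    have h3 : (∀ row ∈ g.drop d, row.length < d + m) ↔
        (g.drop d).countP (d + m ≤ ·.length) = 0 := by
      rw [List.countP_eq_zero]; simp
    rw [h3]; omega
  have hspec : ContainsRectangle g (durfeeHeight m g) (durfeeHeight m g + m) := by
    have := Nat.findGreatest_spec (P := fun d => ContainsRectangle g d (d + m))
      (Nat.zero_le g.length) ⟨Nat.zero_le _, by simp⟩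
    exact this
  constructor
  · intro h
    exact ⟨_, (hdrop _ hspec).1 h⟩
  · rintro ⟨d, hd⟩
    have h1 : ContainsRectangle g d (d + m) :=
      (containsRectangle_iff_le_countP hg _ _).2 hd.ge
    have h2 : d ≤ durfeeHeight m g := Nat.le_findGreatest h1.1 h1
    have h3 : durfeeHeight m g ≤ d := by
      by_contra hlt
      push Not at hlt
      have := (containsRectangle_iff_le_countP hg _ _).1 hspec
      have h4 : g.countP (durfeeHeight m g + m ≤ ·.length) ≤ g.countP (d + m ≤ ·.length) := by
        apply List.countP_mono_left
        intro x _ hx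
        simp only [decide_eq_true_eq] at hx ⊢
        omega
      omega
    have h4 := le_antisymm h2 h3
    unfold rowsBelowDurfee durfeeWidth
    rw [← h4]
    exact (hdrop d h1).2 hd

lemma length_twoModularRow (i : ℕ) : (twoModularRow i).length = i % 2 + i / 2 := by
  unfold twoModularRow
  split_ifs with h <;> simp <;> omega

lemma forall_rowsBelowDurfee_twoModularGraph_iff {n : ℕ} {p : n.Partition}
    (hp : ∀ i ∈ p.parts, ¬ Even i) (k : ℕ) :
    (∀ row ∈ rowsBelowDurfee (k + 2) (twoModularGraph p),
      row.length < durfeeWidth (k + 2) (twoModularGraph p)) ↔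
      ∃ d, p.parts.countP (2 * d + 2 * k + 3 ≤ ·) = d := by
  have hodd : ∀ i ∈ p.parts.sort (· ≥ ·), i % 2 = 1 := by
    intro i hi
    rw [Multiset.mem_sort] at hi
    exact Nat.not_even_iff.1 (hp i hi)
  rw [forall_rowsBelowDurfee_iff]
  · refine exists_congr fun d => ?_
    -- An odd part `i` has row length `(i + 1) / 2`, which is `≥ d + k + 2` iff `i ≥ 2d + 2k + 3`.
    have : (twoModularGraph p).countP (d + (k + 2) ≤ ·.length) =
        p.parts.countP (2 * d + 2 * k + 3 ≤ ·) := by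
      conv_rhs => rw [← Multiset.sort_eq p.parts (· ≥ ·)]
      rw [twoModularGraph, List.countP_map, Multiset.coe_countP]
      apply List.countP_congr
      intro i hi
      have := hodd i hi
      simp only [Function.comp, length_twoModularRow, decide_eq_true_eq]
      omega
    rw [this]
  · rw [twoModularGraph, List.pairwise_map]
    have hs : (p.parts.sort (· ≥ ·)).Pairwise (· ≥ ·) := Multiset.pairwise_sort _ _
    refine hs.imp ?_
    intro a b hab
    simp only [length_twoModularRow]
    omega

end Durfee

/-! ### The recurrence for `Mo` by bijections on multisets of odd numbers. -/

section Counting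

/-- `s` consists of odd numbers with sum `n`, and contains every odd number below `2 k + 2`. -/
def OddWithInitial (k n : ℕ) (s : Multiset ℕ) : Prop :=
  s.sum = n ∧ (∀ i ∈ s, Odd i) ∧ ∀ i < 2 * k + 2, Odd i → i ∈ s

lemma card_filter_partition (n : ℕ) (P : Multiset ℕ → Prop) [DecidablePred P] :
    (univ.filter fun p : n.Partition => P p.parts).card =
      Nat.card {s : Multiset ℕ // s.sum = n ∧ (∀ i ∈ s, 0 < i) ∧ P s} := by
  rw [← Fintype.card_subtype, ← Nat.card_eq_fintype_card]
  exact Nat.card_congr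
    { toFun := fun p => ⟨p.1.parts, p.1.parts_sum, fun _ h => p.1.parts_pos h, p.2⟩
      invFun := fun s => ⟨⟨s.1, fun h => s.2.2.1 _ h, s.2.1⟩, s.2.2.2⟩
      left_inv := fun _ => rfl
      right_inv := fun _ => rfl }

lemma Mo_eq_natCard (k n : ℕ) : Mo k n = Nat.card {s : Multiset ℕ //
    OddWithInitial k n s ∧ ∃ d, s.countP (2 * d + 2 * k + 3 ≤ ·) = d} := by
  classical
  have : Mo k n = (univ.filter fun p : n.Partition => (∀ i ∈ p.parts, Odd i) ∧
      (∀ i < 2 * k + 2, Odd i → i ∈ p.parts) ∧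
      ∃ d, p.parts.countP (2 * d + 2 * k + 3 ≤ ·) = d).card := by
    unfold Mo Nat.Partition.odds Nat.Partition.restricted
    rw [filter_filter]
    congr 1
    refine filter_congr fun p _ => ?_
    simp only [mem_range, ← Nat.not_even_iff_odd]
    exact and_congr_right fun hp =>
      and_congr_right fun _ => forall_rowsBelowDurfee_twoModularGraph_iff hp k
  rw [this, card_filter_partition n (fun s => (∀ i ∈ s, Odd i) ∧
      (∀ i < 2 * k + 2, Odd i → i ∈ s) ∧ ∃ d, s.countP (2 * d + 2 * k + 3 ≤ ·) = d)]
  refine Nat.card_congr (Equiv.subtypeEquivRight fun s => ?_)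
  unfold OddWithInitial
  constructor
  · rintro ⟨h1, -, h2, h3, h4⟩; exact ⟨⟨h1, h2, h3⟩, h4⟩
  · rintro ⟨⟨h1, h2, h3⟩, h4⟩; exact ⟨h1, fun i hi => (h2 i hi).pos, h2, h3, h4⟩

lemma card_odds_eq_natCard (n : ℕ) : (Nat.Partition.odds n).card =
    Nat.card {s : Multiset ℕ // s.sum = n ∧ ∀ i ∈ s, Odd i} := by
  unfold Nat.Partition.odds Nat.Partition.restricted
  rw [card_filter_partition n (fun s => ∀ i ∈ s, ¬ Even i)]
  refine Nat.card_congr (Equiv.subtypeEquivRight fun s => ?_)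
  simp only [Nat.not_even_iff_odd]
  exact ⟨fun h => ⟨h.1, h.2.2⟩, fun h => ⟨h.1, fun i hi => (h.2 i hi).pos, h.2⟩⟩

instance finite_oddWithInitial (k n : ℕ) : Finite {s : Multiset ℕ // OddWithInitial k n s} :=
  Finite.of_injective
    (fun s => (⟨s.1, fun h => (s.2.2.1 _ h).pos, s.2.1⟩ : n.Partition))
    fun _ _ h => Subtype.ext (congrArg Nat.Partition.parts h)

lemma sum_range_two_mul_add_one (k : ℕ) : ∑ i ∈ range k, (2 * i + 1) = k ^ 2 := by
  induction k with
  | zero => rfl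
  | succ k ih => rw [sum_range_succ, ih]; ring

/-- The multiset `{1, 3, …, 2 k + 1}`. -/
def initialOdds (k : ℕ) : Multiset ℕ := (Multiset.range (k + 1)).map (2 * · + 1)

lemma sum_initialOdds (k : ℕ) : (initialOdds k).sum = (k + 1) ^ 2 :=
  sum_range_two_mul_add_one (k + 1)

lemma mem_initialOdds {k i : ℕ} : i ∈ initialOdds k ↔ i < 2 * k + 2 ∧ Odd i := by
  simp only [initialOdds, Multiset.mem_map, Multiset.mem_range]
  constructor
  · rintro ⟨a, ha, rfl⟩; exact ⟨by omega, ⟨a, rfl⟩⟩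
  · rintro ⟨h, a, rfl⟩; exact ⟨a, by omega, rfl⟩

lemma initialOdds_le_iff {k : ℕ} {s : Multiset ℕ} :
    initialOdds k ≤ s ↔ ∀ i < 2 * k + 2, Odd i → i ∈ s := by
  have : (initialOdds k).Nodup :=
    (Multiset.nodup_range _).map fun _ _ h => by omega
  rw [Multiset.le_iff_subset this]
  simp only [Multiset.subset_iff, mem_initialOdds, and_imp]

lemma natCard_oddWithInitial (k n : ℕ) :
    Nat.card {s : Multiset ℕ // OddWithInitial k n s} = Q ((n : ℤ) - ((k : ℤ) + 1) ^ 2) := by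
  unfold Q
  split_ifs with h
  · rw [← Nat.Partition.card_odds_eq_card_distincts, card_odds_eq_natCard]
    obtain ⟨m, hm⟩ := Int.eq_ofNat_of_zero_le h
    have hn : n = m + (k + 1) ^ 2 := by zify; linarith
    rw [hm, Int.toNat_natCast]
    refine Nat.card_congr
      { toFun := fun s => ⟨s.1 - initialOdds k, ?_, ?_⟩
        invFun := fun s => ⟨s.1 + initialOdds k, ?_, ?_, ?_⟩
        left_inv := ?_
        right_inv := ?_ }
    · have h1 := congrArg Multiset.sum (tsub_add_cancel_of_le (initialOdds_le_iff.2 s.2.2.2))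
      rw [Multiset.sum_add, sum_initialOdds, s.2.1] at h1
      omega
    · exact fun i hi => s.2.2.1 i (Multiset.mem_of_le tsub_le_self hi)
    · rw [Multiset.sum_add, sum_initialOdds, s.2.1, hn]
    · intro i hi
      rcases Multiset.mem_add.1 hi with hi | hi
      · exact s.2.2 i hi
      · exact (mem_initialOdds.1 hi).2
    · exact initialOdds_le_iff.1 (Multiset.le_add_left _ _)
    · intro s
      exact Subtype.ext (tsub_add_cancel_of_le (initialOdds_le_iff.2 s.2.2.2))
    · intro s
      exact Subtype.ext (add_tsub_cancel_right _ _)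
  · rw [Nat.card_eq_zero]
    left
    refine ⟨fun s => h ?_⟩
    obtain ⟨t, ht⟩ := Multiset.le_iff_exists_add.1 (initialOdds_le_iff.2 s.2.2.2)
    have h1 := congrArg Multiset.sum ht
    rw [Multiset.sum_add, sum_initialOdds, s.2.1] at h1
    generalize t.sum = m at h1
    zify at h1
    omega

lemma Mo_eq_zero_of_lt {k n : ℕ} (h : n < k) : Mo k n = 0 := by
  have h1 := natCard_oddWithInitial k n
  have h2 : ¬ (0 : ℤ) ≤ (n : ℤ) - ((k : ℤ) + 1) ^ 2 := by
    have : (n : ℤ) < k := by exact_mod_cast h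
    nlinarith
  rw [Q, if_neg h2, Nat.card_eq_zero] at h1
  have h3 : IsEmpty {s : Multiset ℕ // OddWithInitial k n s} := h1.resolve_right
    (fun h => h.not_finite (finite_oddWithInitial k n))
  rw [Mo_eq_natCard, Nat.card_eq_zero]
  exact Or.inl ⟨fun s => h3.false ⟨s.1, s.2.1⟩⟩

/-- The triples `(d, b, r)` in which `b` has `d` odd entries, all at least `2 d + c`, and `r` has
odd entries that are at most `2 d + c` and include every odd number below `c`. Adding the part
`2 d + c` to `b + r` gives the partitions that violate the condition on the Durfee rectangle;
adding `2` to each entry of `b` and the part `c` gives those that satisfy the next condition. -/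
def IsDurfeeTriple (c n : ℕ) (z : ℕ × Multiset ℕ × Multiset ℕ) : Prop :=
  z.2.1.card = z.1 ∧ (∀ i ∈ z.2.1, Odd i ∧ 2 * z.1 + c ≤ i) ∧
    (∀ i ∈ z.2.2, Odd i ∧ i ≤ 2 * z.1 + c) ∧ (∀ i < c, Odd i → i ∈ z.2.2) ∧
    z.2.1.sum + z.2.2.sum + (2 * z.1 + c) = n

lemma isDurfeeTriple_mk {c n d : ℕ} {b r : Multiset ℕ} : IsDurfeeTriple c n (d, b, r) ↔
    b.card = d ∧ (∀ i ∈ b, Odd i ∧ 2 * d + c ≤ i) ∧ (∀ i ∈ r, Odd i ∧ i ≤ 2 * d + c) ∧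
      (∀ i < c, Odd i → i ∈ r) ∧ b.sum + r.sum + (2 * d + c) = n := Iff.rfl

lemma countP_eq_card {s : Multiset ℕ} {c : ℕ} (h : ∀ i ∈ s, c ≤ i) :
    s.countP (c ≤ ·) = s.card := Multiset.countP_eq_card.2 h

lemma countP_eq_zero {s : Multiset ℕ} {c : ℕ} (h : ∀ i ∈ s, i < c) :
    s.countP (c ≤ ·) = 0 := Multiset.countP_eq_zero.2 fun i hi => not_le.2 (h i hi)

lemma countP_le_antitone (s : Multiset ℕ) {c c' : ℕ} (h : c ≤ c') :
    s.countP (c' ≤ ·) ≤ s.countP (c ≤ ·) := by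
  rw [Multiset.countP_eq_card_filter, Multiset.countP_eq_card_filter]
  exact Multiset.card_le_card (Multiset.monotone_filter_right s fun i hi => h.trans hi)

lemma sum_map_add_two (b : Multiset ℕ) : (b.map (· + 2)).sum = b.sum + 2 * b.card := by
  induction b using Multiset.induction with
  | empty => rfl
  | cons a b ih => simp [ih]; omega

lemma filter_map_add_two {b r : Multiset ℕ} {e : ℕ} (hb : ∀ i ∈ b, e ≤ i)
    (hr : ∀ i ∈ r, i ≤ e) :
    (b.map (· + 2) + r).filter (e + 2 ≤ ·) = b.map (· + 2) := by
  rw [Multiset.filter_add, Multiset.filter_eq_self.2, Multiset.filter_eq_nil.2, add_zero]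
  · intro i hi; have := hr i hi; omega
  · intro i hi
    obtain ⟨j, hj, rfl⟩ := Multiset.mem_map.1 hi
    have := hb j hj; omega

/-- A nonincreasing function of `d` meets the diagonal at most once; so `d` can be recovered from
the multiset. -/
lemma countP_diagonal_unique {s : Multiset ℕ} {c d d' : ℕ} (h : s.countP (2 * d + c ≤ ·) = d)
    (h' : s.countP (2 * d' + c ≤ ·) = d') : d = d' := by
  rcases lt_trichotomy d d' with hlt | rfl | hlt
  · have := countP_le_antitone s (show 2 * d + c ≤ 2 * d' + c by omega); omega
  · rfl
  · have := countP_le_antitone s (show 2 * d' + c ≤ 2 * d + c by omega); omega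

lemma natCard_isDurfeeTriple_eq_Mo_succ (k n : ℕ) :
    Nat.card {z // IsDurfeeTriple (2 * k + 3) n z} = Mo (k + 1) n := by
  rw [Mo_eq_natCard]
  have hc : ∀ z, IsDurfeeTriple (2 * k + 3) n z →
      (z.2.1.map (· + 2) + ((2 * k + 3) ::ₘ z.2.2)).countP (2 * z.1 + (2 * k + 5) ≤ ·) = z.1 := by
    rintro ⟨d, b, r⟩ hz
    obtain ⟨h1, h2, h3, -, -⟩ := isDurfeeTriple_mk.1 hz
    dsimp only
    rw [Multiset.countP_add, countP_eq_card, countP_eq_zero, Multiset.card_map, h1, add_zero]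
    · intro i hi
      rcases Multiset.mem_cons.1 hi with rfl | hi
      · omega
      · have := (h3 i hi).2; omega
    · intro i hi
      obtain ⟨j, hj, rfl⟩ := Multiset.mem_map.1 hi
      have := (h2 j hj).2; omega
  refine Nat.card_congr (Equiv.ofBijective (fun z =>
    ⟨z.1.2.1.map (· + 2) + ((2 * k + 3) ::ₘ z.1.2.2), ?_, z.1.1, ?_⟩) ⟨?_, ?_⟩)
  · obtain ⟨⟨d, b, r⟩, hz⟩ := z
    obtain ⟨h1, h2, h3, h4, h5⟩ := isDurfeeTriple_mk.1 hz
    dsimp only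
    refine ⟨?_, ?_, ?_⟩
    · rw [Multiset.sum_add, Multiset.sum_cons, sum_map_add_two]; omega
    · intro i hi
      rcases Multiset.mem_add.1 hi with hi | hi
      · obtain ⟨j, hj, rfl⟩ := Multiset.mem_map.1 hi
        have := (h2 j hj).1; grind
      · rcases Multiset.mem_cons.1 hi with rfl | hi
        · exact ⟨k + 1, by ring⟩
        · exact (h3 i hi).1
    · intro i hi ho
      rw [Multiset.mem_add, Multiset.mem_cons]
      right
      rcases eq_or_ne i (2 * k + 3) with h | h
      · exact Or.inl h
      · exact Or.inr (h4 i (by omega) ho)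
  · exact hc z.1 z.2
  · rintro ⟨⟨d, b, r⟩, hz⟩ ⟨⟨d', b', r'⟩, hz'⟩ h
    rw [Subtype.mk.injEq] at h
    dsimp only at h
    have e1 := hc _ hz
    have e2 := hc _ hz'
    dsimp only at e1 e2
    rw [← h] at e2
    obtain rfl : d = d' := countP_diagonal_unique e1 e2
    obtain ⟨-, h2, h3, -, -⟩ := isDurfeeTriple_mk.1 hz
    obtain ⟨-, h2', h3', -, -⟩ := isDurfeeTriple_mk.1 hz'
    have f1 := filter_map_add_two (b := b) (r := (2 * k + 3) ::ₘ r) (e := 2 * d + (2 * k + 3))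
      (fun i hi => (h2 i hi).2) (fun i hi => by
        rcases Multiset.mem_cons.1 hi with rfl | hi
        · omega
        · exact (h3 i hi).2)
    have f2 := filter_map_add_two (b := b') (r := (2 * k + 3) ::ₘ r') (e := 2 * d + (2 * k + 3))
      (fun i hi => (h2' i hi).2) (fun i hi => by
        rcases Multiset.mem_cons.1 hi with rfl | hi
        · omega
        · exact (h3' i hi).2)
    rw [h, f2] at f1
    obtain rfl : b' = b :=
      Multiset.map_injective (fun a b h => by simpa using h) f1
    obtain rfl : r = r' := (Multiset.cons_inj_right _).1 (add_left_cancel h)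
    rfl
  · rintro ⟨s, ⟨h1, h2, h3⟩, d, hd⟩
    -- The inserted copy of `2k + 3` is found among the small parts, as it lies below every
    -- threshold `2d + 2k + 5`.
    obtain ⟨r, hr⟩ := Multiset.exists_cons_of_mem (a := 2 * k + 3)
      (s := s.filter (¬ 2 * d + (2 * k + 5) ≤ ·))
      (Multiset.mem_filter.2 ⟨h3 _ (by omega) ⟨k + 1, by ring⟩, by omega⟩)
    have hb : ((s.filter (2 * d + (2 * k + 5) ≤ ·)).map (· - 2)).map (· + 2) =
        s.filter (2 * d + (2 * k + 5) ≤ ·) := by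
      rw [Multiset.map_map]
      conv_rhs => rw [← Multiset.map_id (s.filter (2 * d + (2 * k + 5) ≤ ·))]
      refine Multiset.map_congr rfl fun i hi => ?_
      have := (Multiset.mem_filter.1 hi).2
      simp only [Function.comp, id]
      omega
    have hs : ((s.filter (2 * d + (2 * k + 5) ≤ ·)).map (· - 2)).map (· + 2) +
        ((2 * k + 3) ::ₘ r) = s := by
      rw [hb, ← hr, Multiset.filter_add_not]
    have hd' : (s.filter (2 * d + (2 * k + 5) ≤ ·)).card = d := by
      rw [← Multiset.countP_eq_card_filter]; exact hd
    refine ⟨⟨⟨d, (s.filter (2 * d + (2 * k + 5) ≤ ·)).map (· - 2), r⟩, ?_, ?_, ?_, ?_, ?_⟩,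
      Subtype.ext hs⟩
    · dsimp only
      rw [Multiset.card_map, hd']
    · intro i hi
      obtain ⟨j, hj, rfl⟩ := Multiset.mem_map.1 hi
      obtain ⟨hj1, hj2⟩ := Multiset.mem_filter.1 hj
      have := h2 j hj1
      dsimp only
      exact ⟨by grind, by omega⟩
    · intro i hi
      have : i ∈ s.filter (¬ 2 * d + (2 * k + 5) ≤ ·) := hr ▸ Multiset.mem_cons_of_mem hi
      obtain ⟨hj1, hj2⟩ := Multiset.mem_filter.1 this
      have := h2 i hj1
      dsimp only
      exact ⟨this, by grind⟩
    · intro i hi ho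
      have : i ∈ s.filter (¬ 2 * d + (2 * k + 5) ≤ ·) :=
        Multiset.mem_filter.2 ⟨h3 i (by omega) ho, by omega⟩
      rw [hr, Multiset.mem_cons] at this
      exact this.resolve_left (by omega)
    · have := congrArg Multiset.sum hs
      rw [Multiset.sum_add, Multiset.sum_cons, sum_map_add_two, Multiset.card_map, hd', h1] at this
      dsimp only
      omega

/-- With `c = 2k + 3`, the condition fails iff for some `d` more than `d` parts are `≥ 2d + c` but
at most `d` are `≥ 2d + c + 2`. By parity `2d + c` is then a part; one copy is removed, and `b`
consists of the `d` largest remaining parts. -/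
lemma natCard_isDurfeeTriple_eq_natCard_not (k n : ℕ) :
    Nat.card {z // IsDurfeeTriple (2 * k + 3) n z} = Nat.card {s : Multiset ℕ //
      OddWithInitial k n s ∧ ¬ ∃ d, s.countP (2 * d + 2 * k + 3 ≤ ·) = d} := by
  have hc1 : ∀ z, IsDurfeeTriple (2 * k + 3) n z →
      z.1 + 1 ≤ (z.2.1 + ((2 * z.1 + (2 * k + 3)) ::ₘ z.2.2)).countP
        (2 * z.1 + (2 * k + 3) ≤ ·) := by
    rintro ⟨d, b, r⟩ hz
    obtain ⟨h1, h2, h3, -, -⟩ := isDurfeeTriple_mk.1 hz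
    dsimp only
    rw [Multiset.countP_add, countP_eq_card (fun i hi => (h2 i hi).2), Multiset.countP_cons, h1,
      if_pos le_rfl]
    omega
  have hc2 : ∀ z, IsDurfeeTriple (2 * k + 3) n z →
      (z.2.1 + ((2 * z.1 + (2 * k + 3)) ::ₘ z.2.2)).countP
        (2 * (z.1 + 1) + (2 * k + 3) ≤ ·) ≤ z.1 := by
    rintro ⟨d, b, r⟩ hz
    obtain ⟨h1, h2, h3, -, -⟩ := isDurfeeTriple_mk.1 hz
    dsimp only
    rw [Multiset.countP_add, countP_eq_zero (s := _ ::ₘ r), add_zero, ← h1]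
    · exact Multiset.countP_le_card _ _
    · intro i hi
      rcases Multiset.mem_cons.1 hi with rfl | hi
      · omega
      · have := (h3 i hi).2; omega
  refine Nat.card_congr (Equiv.ofBijective (fun z =>
    ⟨z.1.2.1 + ((2 * z.1.1 + (2 * k + 3)) ::ₘ z.1.2.2), ?_, ?_⟩) ⟨?_, ?_⟩)
  · obtain ⟨⟨d, b, r⟩, hz⟩ := z
    obtain ⟨h1, h2, h3, h4, h5⟩ := isDurfeeTriple_mk.1 hz
    dsimp only
    refine ⟨?_, ?_, ?_⟩
    · rw [Multiset.sum_add, Multiset.sum_cons]; omega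
    · intro i hi
      rcases Multiset.mem_add.1 hi with hi | hi
      · exact (h2 i hi).1
      · rcases Multiset.mem_cons.1 hi with rfl | hi
        · exact ⟨d + k + 1, by ring⟩
        · exact (h3 i hi).1
    · intro i hi ho
      rw [Multiset.mem_add, Multiset.mem_cons]
      exact Or.inr (Or.inr (h4 i (by omega) ho))
  · rintro ⟨e, he⟩
    have e1 := hc1 z.1 z.2
    have e2 := hc2 z.1 z.2
    rw [add_assoc] at he
    rcases le_or_gt e z.1.1 with hlt | hlt
    · have := countP_le_antitone (z.1.2.1 + ((2 * z.1.1 + (2 * k + 3)) ::ₘ z.1.2.2))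
        (show 2 * e + (2 * k + 3) ≤ 2 * z.1.1 + (2 * k + 3) by omega)
      omega
    · have := countP_le_antitone (z.1.2.1 + ((2 * z.1.1 + (2 * k + 3)) ::ₘ z.1.2.2))
        (show 2 * (z.1.1 + 1) + (2 * k + 3) ≤ 2 * e + (2 * k + 3) by omega)
      omega
  · rintro ⟨⟨d, b, r⟩, hz⟩ ⟨⟨d', b', r'⟩, hz'⟩ h
    rw [Subtype.mk.injEq] at h
    dsimp only at h
    have e1 := hc1 _ hz
    have e2 := hc2 _ hz
    have e1' := hc1 _ hz'
    have e2' := hc2 _ hz'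
    dsimp only at e1 e2 e1' e2'
    rw [← h] at e1' e2'
    obtain rfl : d = d' := by
      rcases lt_trichotomy d d' with hlt | rfl | hlt
      · have := countP_le_antitone (b + ((2 * d + (2 * k + 3)) ::ₘ r))
          (show 2 * (d + 1) + (2 * k + 3) ≤ 2 * d' + (2 * k + 3) by omega)
        omega
      · rfl
      · have := countP_le_antitone (b + ((2 * d + (2 * k + 3)) ::ₘ r))
          (show 2 * (d' + 1) + (2 * k + 3) ≤ 2 * d + (2 * k + 3) by omega)
        omega
    obtain ⟨g1, h2, h3, -, -⟩ := isDurfeeTriple_mk.1 hz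
    obtain ⟨g1', h2', h3', -, -⟩ := isDurfeeTriple_mk.1 hz'
    set e := 2 * d + (2 * k + 3) with he
    rw [Multiset.add_cons, Multiset.add_cons, Multiset.cons_inj_right] at h
    have filt : ∀ b r : Multiset ℕ, (∀ i ∈ r, Odd i ∧ i ≤ e) →
        (b + r).filter (e < ·) = b.filter (e < ·) := by
      intro b r hr
      rw [Multiset.filter_add, add_eq_left, Multiset.filter_eq_nil]
      intro i hi
      have := (hr i hi).2
      omega
    -- The entries above `e` determine `b`: copies of `e` fill it up to `d` entries.
    have rep : ∀ b : Multiset ℕ, (∀ i ∈ b, Odd i ∧ e ≤ i) → b.card = d →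
        b = b.filter (e < ·) + Multiset.replicate (d - (b.filter (e < ·)).card) e := by
      intro b hb hd
      have h1 : b.filter (¬ e < ·) = Multiset.replicate (b.filter (¬ e < ·)).card e := by
        rw [Multiset.eq_replicate_card]
        intro i hi
        obtain ⟨hi1, hi2⟩ := Multiset.mem_filter.1 hi
        have := (hb i hi1).2
        omega
      have h2 := Multiset.filter_add_not (e < ·) b
      have h3 := congrArg Multiset.card h2
      rw [Multiset.card_add, hd] at h3
      have h4 : d - (b.filter (e < ·)).card = (b.filter (¬ e < ·)).card := by omega
      rw [h4, ← h1, h2]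
    have hf : b.filter (e < ·) = b'.filter (e < ·) := by
      rw [← filt b r h3, h, filt b' r' h3']
    obtain rfl : b = b' := by
      rw [rep b h2 g1, rep b' h2' g1', hf]
    obtain rfl : r = r' := add_left_cancel h
    rfl
  · rintro ⟨s, ⟨h1, h2, h3⟩, hn⟩
    have hex : ∃ e, s.countP (2 * e + (2 * k + 3) ≤ ·) < e :=
      ⟨s.card + 1, Nat.lt_succ_of_le (Multiset.countP_le_card _ _)⟩
    obtain ⟨d, hd1, hd2⟩ : ∃ d, d + 1 ≤ s.countP (2 * d + (2 * k + 3) ≤ ·) ∧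
        s.countP (2 * (d + 1) + (2 * k + 3) ≤ ·) ≤ d := by
      classical
      -- `d + 1` is the first index whose count falls strictly below the diagonal; at `d` the count
      -- is at least `d`, and equality is excluded by `hn`.
      have hpos : Nat.find hex ≠ 0 := by
        intro h0
        have := Nat.find_spec hex
        omega
      obtain ⟨d, hd⟩ := Nat.exists_eq_add_one_of_ne_zero hpos
      have s1 := Nat.find_spec hex
      have s2 := Nat.find_min hex (m := d) (by omega)
      rw [hd] at s1
      have s3 : s.countP (2 * d + (2 * k + 3) ≤ ·) ≠ d := fun h => hn ⟨d, h⟩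
      exact ⟨d, by omega, by omega⟩
    set e := 2 * d + (2 * k + 3) with he
    have hlow : s.filter (2 * (d + 1) + (2 * k + 3) ≤ ·) ≤ s.filter (e ≤ ·) :=
      Multiset.monotone_filter_right s fun i hi => by omega
    rw [Multiset.countP_eq_card_filter] at hd1 hd2
    obtain ⟨t, ht⟩ := Multiset.le_iff_exists_add.1 hlow
    have ht' : t = Multiset.replicate t.card e := by
      rw [Multiset.eq_replicate_card]
      intro i hi
      have m1 : i ∈ s.filter (e ≤ ·) := by rw [ht]; exact Multiset.mem_add.2 (Or.inr hi)
      obtain ⟨m2, m3⟩ := Multiset.mem_filter.1 m1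
      by_contra hne
      have hodd := h2 i m2
      have m4 : 2 * (d + 1) + (2 * k + 3) ≤ i := by grind
      have c1 := congrArg (Multiset.count i) ht
      rw [Multiset.count_add, Multiset.count_filter, Multiset.count_filter, if_pos m3,
        if_pos m4] at c1
      have := Multiset.count_pos.2 hi
      omega
    have hcard := congrArg Multiset.card ht
    rw [Multiset.card_add] at hcard
    -- The copies of `e` are shared out: `d - |X|` complete `b`, one is the removed part, and the
    -- other `u` go to `r`.
    obtain ⟨u, hu⟩ : ∃ u, t.card = d - (s.filter (2 * (d + 1) + (2 * k + 3) ≤ ·)).card + (u + 1) :=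
      ⟨t.card - (d - (s.filter (2 * (d + 1) + (2 * k + 3) ≤ ·)).card) - 1, by omega⟩
    set X := s.filter (2 * (d + 1) + (2 * k + 3) ≤ ·) with hX
    have hs : X + Multiset.replicate (d - X.card) e +
        (e ::ₘ (Multiset.replicate u e + s.filter (¬ e ≤ ·))) = s := by
      conv_rhs => rw [← Multiset.filter_add_not (e ≤ ·) s, ht, ht', hu,
        Multiset.replicate_add, Multiset.replicate_succ]
      simp only [← Multiset.singleton_add]
      abel
    have hmem : ∀ i, i ∈ X + Multiset.replicate (d - X.card) e +
        (e ::ₘ (Multiset.replicate u e + s.filter (¬ e ≤ ·))) → i ∈ s := fun i hi => hs ▸ hi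
    refine ⟨⟨⟨d, X + Multiset.replicate (d - X.card) e,
      Multiset.replicate u e + s.filter (¬ e ≤ ·)⟩, ?_, ?_, ?_, ?_, ?_⟩, Subtype.ext hs⟩
    · dsimp only
      rw [Multiset.card_add, Multiset.card_replicate]
      omega
    · intro i hi
      refine ⟨h2 i (hmem i (Multiset.mem_add.2 (Or.inl hi))), ?_⟩
      rcases Multiset.mem_add.1 hi with hi | hi
      · have := (Multiset.mem_filter.1 hi).2
        dsimp only; omega
      · rw [Multiset.eq_of_mem_replicate hi]
    · intro i hi
      refine ⟨h2 i (hmem i (Multiset.mem_add.2 (Or.inr (Multiset.mem_cons_of_mem hi)))), ?_⟩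
      rcases Multiset.mem_add.1 hi with hi | hi
      · rw [Multiset.eq_of_mem_replicate hi]
      · have := (Multiset.mem_filter.1 hi).2
        dsimp only; omega
    · intro i hi ho
      have hi' : i < 2 * k + 2 := by obtain ⟨a, rfl⟩ := ho; omega
      exact Multiset.mem_add.2 (Or.inr (Multiset.mem_filter.2 ⟨h3 i hi' ho, by omega⟩))
    · have := congrArg Multiset.sum hs
      rw [Multiset.sum_add, Multiset.sum_cons, h1] at this
      dsimp only
      omega

theorem Mo_add_Mo_succ (k n : ℕ) :
    Mo k n + Mo (k + 1) n = Q ((n : ℤ) - ((k : ℤ) + 1) ^ 2) := by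
  classical
  rw [← natCard_oddWithInitial, ← natCard_isDurfeeTriple_eq_Mo_succ,
    natCard_isDurfeeTriple_eq_natCard_not, Mo_eq_natCard]
  have := finite_oddWithInitial k n
  have e := fun P : Multiset ℕ → Prop =>
    Nat.card_congr (Equiv.subtypeSubtypeEquivSubtypeInter (OddWithInitial k n) P)
  rw [← e, ← e, ← Nat.card_sum]
  exact Nat.card_congr (Equiv.sumCompl _)

end Counting

end TruncTheta

namespace TruncTheta

/-! ### Theta product identities in a nilpotent variable. -/

section NilpotentProducts

variable {R : Type*} [CommRing R]

lemma prod_range_two_mul {M : Type*} [CommMonoid M] (f : ℕ → M) (n : ℕ) :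
    ∏ i ∈ range (2 * n), f i = ∏ i ∈ range n, (f (2 * i) * f (2 * i + 1)) := by
  induction n with
  | zero => rfl
  | succ n ih => rw [mul_add_one, prod_range_succ, prod_range_succ, ih, prod_range_succ, mul_assoc]

lemma prod_range_three_mul {M : Type*} [CommMonoid M] (f : ℕ → M) (n : ℕ) :
    ∏ i ∈ range (3 * n), f i =
      ∏ i ∈ range n, (f (3 * i) * f (3 * i + 1) * f (3 * i + 2)) := by
  induction n with
  | zero => rfl
  | succ n ih =>
    rw [mul_add_one, prod_range_succ, prod_range_succ, prod_range_succ, ih, prod_range_succ,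
      mul_assoc, mul_assoc, mul_assoc]

lemma prod_range_mul_ite_dvd {M : Type*} [CommMonoid M] (f : ℕ → M) {r : ℕ} (hr : r ≠ 0) (n : ℕ) :
    ∏ i ∈ range (r * n), (if r ∣ i + 1 then f (i + 1) else 1) =
      ∏ i ∈ range n, f (r * (i + 1)) := by
  induction n with
  | zero => simp
  | succ n ih =>
    rw [mul_add_one, prod_range_add, ih, prod_range_succ]
    congr 1
    obtain ⟨r, rfl⟩ := Nat.exists_eq_add_one_of_ne_zero hr
    rw [prod_range_succ, prod_eq_one, one_mul, if_pos ⟨n + 1, by ring⟩]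
    · congr 1
    · intro i hi
      rw [mem_range] at hi
      refine if_neg fun h => ?_
      rw [add_assoc, Nat.dvd_add_right (Dvd.intro _ rfl)] at h
      have := Nat.le_of_dvd (by omega) h
      omega

lemma prod_range_eq_of_le {M : Type*} [CommMonoid M] {f : ℕ → M} {N m n : ℕ}
    (hf : ∀ i, N ≤ i → f i = 1) (hm : N ≤ m) (hn : N ≤ n) :
    ∏ i ∈ range m, f i = ∏ i ∈ range n, f i := by
  have key : ∀ l, N ≤ l → ∏ i ∈ range l, f i = ∏ i ∈ range N, f i := fun l hl => by
    rw [← prod_range_mul_prod_Ico f hl, prod_eq_one fun i hi => hf i (mem_Ico.1 hi).1, mul_one]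
  rw [key m hm, key n hn]

/-- Gauss's identity for the alternating theta series, in a ring with a nilpotent element. -/
lemma prod_one_add_mul_sum_thetaTerm {y : R} {N n : ℕ} (hy : y ^ N = 0) (hn : N ≤ n) :
    (∏ i ∈ range (2 * n), (1 + y ^ (i + 1))) *
      ∑ k ∈ range (2 * n + 1), thetaTerm (-y) (-y) ((k : ℤ) - n) =
    ∏ i ∈ range n, (1 - y ^ (i + 1)) := by
  rw [← tripleProduct_of_pow_eq_zero hy (dvd_neg.2 dvd_rfl) (dvd_neg.2 dvd_rfl) hn]
  have hodd : ∀ i, 1 + -y * (-y * -y) ^ i = 1 - y ^ (2 * i + 1) := fun i => by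
    rw [neg_mul_neg, ← pow_two, ← pow_mul]; ring
  have heven : ∀ i, 1 - (-y * -y) ^ (i + 1) = 1 - y ^ (2 * i + 1 + 1) := fun i => by
    rw [neg_mul_neg, ← pow_two, ← pow_mul]; ring
  simp only [hodd, heven]
  have h1 : (∏ i ∈ range n, (1 - y ^ (2 * i + 1))) * ∏ i ∈ range n, (1 - y ^ (2 * i + 1 + 1)) =
      ∏ i ∈ range (2 * n), (1 - y ^ (i + 1)) := by
    rw [prod_range_two_mul, prod_mul_distrib]
  have h2 : (∏ i ∈ range (2 * n), (1 + y ^ (i + 1))) * ∏ i ∈ range (2 * n), (1 - y ^ (i + 1)) =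
      ∏ i ∈ range n, (1 - y ^ (2 * i + 1 + 1)) := by
    rw [← prod_mul_distrib]
    have : ∀ i, (1 + y ^ (i + 1)) * (1 - y ^ (i + 1)) = 1 - y ^ (2 * i + 1 + 1) := fun i => by ring
    simp only [this]
    exact prod_range_eq_of_le (N := N)
      (fun i hi => by rw [pow_eq_zero_of_le (by omega) hy, sub_zero]) (by omega) hn
  have h3 : ∏ i ∈ range (2 * n), (1 - y ^ (i + 1)) = ∏ i ∈ range n, (1 - y ^ (i + 1)) :=
    prod_range_eq_of_le (N := N)
      (fun i hi => by rw [pow_eq_zero_of_le (by omega) hy, sub_zero]) (by omega) hn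
  -- With `O`, `E` the products over odd and even exponents and `P = O * E`, the theta sum is `O * O
  -- * E`. Since `∏ (1 + y ^ i) * P = E`, the left side is `O * E = P`.
  rw [← h3, mul_assoc _ _ (∏ i ∈ range n, (1 - y ^ (2 * i + 1 + 1))), h1, mul_left_comm, h2, h1]

/-- The pentagonal number theorem, in a ring with a nilpotent element. -/
lemma prod_one_sub_eq_sum_thetaTerm {y : R} {N m n : ℕ} (hy : y ^ N = 0) (hm : N ≤ m)
    (hn : N ≤ n) :
    ∏ i ∈ range m, (1 - y ^ (i + 1)) =
      ∑ k ∈ range (2 * n + 1), thetaTerm (-y) (-y ^ 2) ((k : ℤ) - n) := by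
  rw [← tripleProduct_of_pow_eq_zero hy (dvd_neg.2 dvd_rfl)
    (dvd_neg.2 (dvd_pow_self y two_ne_zero)) hn, ← prod_mul_distrib, ← prod_mul_distrib]
  have : ∀ i, (1 + -y * (-y * -y ^ 2) ^ i) * (1 + -y ^ 2 * (-y * -y ^ 2) ^ i) *
      (1 - (-y * -y ^ 2) ^ (i + 1)) =
      (1 - y ^ (3 * i + 1)) * (1 - y ^ (3 * i + 1 + 1)) * (1 - y ^ (3 * i + 2 + 1)) := fun i => by
    rw [neg_mul_neg, ← pow_succ', ← pow_mul, ← pow_mul]; ring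
  simp only [this]
  rw [← prod_range_three_mul fun i => 1 - y ^ (i + 1)]
  exact prod_range_eq_of_le (N := N)
    (fun i hi => by rw [pow_eq_zero_of_le (by omega) hy, sub_zero]) hm (by omega)

/-- The pentagonal number theorem at `-x`: `1 - (-x) ^ i` is `1 + x ^ i` for odd `i` and `1 - x ^ i`
for even `i`. -/
lemma prod_coprime_two_mul_prod {x : R} {N n : ℕ} (hx : x ^ N = 0) (hn : N ≤ n) :
    (∏ i ∈ range (2 * n), (if 2 ∣ i + 1 then 1 else 1 + x ^ (i + 1))) *
      ∏ i ∈ range n, (1 - x ^ (2 * (i + 1))) =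
    ∑ k ∈ range (2 * n + 1), thetaTerm x (-x ^ 2) ((k : ℤ) - n) := by
  have h := prod_one_sub_eq_sum_thetaTerm (y := -x) (m := 2 * n) (n := n)
    (by rw [neg_pow, hx, mul_zero]) (show N ≤ _ by omega) hn
  rw [neg_neg, neg_sq] at h
  rw [← h, ← prod_range_mul_ite_dvd (fun i => 1 - x ^ i) two_ne_zero, ← prod_mul_distrib]
  refine prod_congr rfl fun i _ => ?_
  split_ifs with h
  · rw [one_mul, (even_iff_two_dvd.2 h).neg_pow]
  · rw [mul_one, (Nat.not_even_iff_odd.1 (mt even_iff_two_dvd.1 h)).neg_pow, sub_neg_eq_add]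

/-- The triple product at `a = x`, `b = x ^ 2`: its three families of factors are the residue
classes of the exponent modulo `3`. -/
lemma prod_coprime_three_mul_prod {x : R} {N n : ℕ} (hx : x ^ N = 0) (hn : N ≤ n) :
    (∏ i ∈ range (3 * n), (if 3 ∣ i + 1 then 1 else 1 + x ^ (i + 1))) *
      ∏ i ∈ range n, (1 - x ^ (3 * (i + 1))) =
    ∑ k ∈ range (2 * n + 1), thetaTerm x (x ^ 2) ((k : ℤ) - n) := by
  rw [← tripleProduct_of_pow_eq_zero hx dvd_rfl (dvd_pow_self x two_ne_zero) hn,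
    prod_range_three_mul, ← prod_mul_distrib, ← prod_mul_distrib, ← prod_mul_distrib]
  refine prod_congr rfl fun i _ => ?_
  rw [if_neg (by omega), if_neg (by omega), if_pos (by omega), ← pow_succ', ← pow_mul, ← pow_mul]
  ring

end NilpotentProducts

/-! ### Generating functions, pentagonal exponents and the truncated identities. -/

section GeneratingFunctions

open PowerSeries

/-- The generating function of the partitions into distinct parts not divisible by `r`; for
`r = 0` this is no restriction. -/
noncomputable def distinctSeries (r : ℕ) : ℤ⟦X⟧ := PowerSeries.mk fun n => (Qr r n : ℤ)

lemma Qr_zero (n : ℕ) : Qr 0 n = Q n := by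
  unfold Qr Q
  rw [if_pos (by positivity), Int.toNat_natCast, filter_true_of_mem]
  intro p _ i hi h
  have := p.parts_pos hi
  rw [zero_dvd_iff] at h
  omega

open scoped PowerSeries.WithPiTopology in
lemma hasProd_mk_Qr (R : Type*) [CommSemiring R] [TopologicalSpace R] [T2Space R] (r : ℕ) :
    HasProd (fun i => if r ∣ i + 1 then 1 else 1 + (X : R⟦X⟧) ^ (i + 1))
      (PowerSeries.mk fun n => (Qr r n : R)) := by
  convert! Nat.Partition.hasProd_genFun (fun i c => if c < 2 ∧ ¬ r ∣ i then (1 : R) else 0) using 1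
  · ext1 i
    rw [tsum_eq_single 0 fun j hj => by
      rw [if_neg (by omega), zero_smul]]
    by_cases h : r ∣ i + 1 <;> simp [h]
  · unfold Nat.Partition.genFun
    congr 1
    ext n
    rw [Qr, Nat.Partition.distincts, filter_filter, card_filter]
    push_cast
    refine sum_congr rfl fun p _ => ?_
    rw [Finsupp.prod, prod_boole]
    congr 1
    simp only [Multiset.toFinsupp_support, Multiset.mem_toFinset, Multiset.toFinsupp_apply,
      eq_iff_iff, Multiset.nodup_iff_count_le_one]
    constructor
    · rintro ⟨h1, h2⟩ i hi
      exact ⟨Nat.lt_succ_of_le (h1 i), h2 i hi⟩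
    · intro h
      refine ⟨fun i => ?_, fun i hi => (h i hi).2⟩
      by_cases hi : i ∈ p.parts
      · exact Nat.le_of_lt_succ (h i hi).1
      · rw [Multiset.count_eq_zero_of_notMem hi]; exact zero_le_one

open scoped PowerSeries.WithPiTopology in
-- Convergence is coefficientwise, so some finite product over a set containing `range m` already
-- agrees with `F` below degree `N`; its extra factors are `1` modulo `X ^ N`.
lemma X_pow_dvd_sub_prod_of_hasProd {f : ℕ → ℤ⟦X⟧} {F : ℤ⟦X⟧} (hF : HasProd f F) {N : ℕ}
    (hf : ∀ i, N ≤ i → X ^ N ∣ f i - 1) {m : ℕ} (hm : N ≤ m) :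
    X ^ N ∣ F - ∏ i ∈ range m, f i := by
  rw [HasProd, WithPiTopology.tendsto_iff_coeff_tendsto] at hF
  have h1 : ∀ᶠ s in SummationFilter.unconditional ℕ |>.filter,
      ∀ n ∈ range N, coeff n (∏ i ∈ s, f i) = coeff n F :=
    (Filter.eventually_all_finset _).2 fun n _ => by simpa using hF n
  rw [SummationFilter.unconditional_filter] at h1
  obtain ⟨s, hs1, hs2⟩ := (h1.and (Filter.eventually_ge_atTop (range m))).exists
  have h2 : X ^ N ∣ F - ∏ i ∈ s, f i := X_pow_dvd_iff.2 fun n hn => by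
    rw [map_sub, hs1 n (mem_range.2 hn), sub_self]
  have h3 : X ^ N ∣ (∏ i ∈ s, f i) - ∏ i ∈ range m, f i := by
    rw [← Ideal.mem_span_singleton, ← Ideal.Quotient.eq, map_prod, map_prod]
    refine (prod_subset hs2 fun i _ hi => ?_).symm
    rw [← map_one (Ideal.Quotient.mk _), Ideal.Quotient.eq, Ideal.mem_span_singleton]
    exact hf i (by rw [mem_range] at hi; omega)
  have := dvd_add h2 h3
  rwa [sub_add_sub_cancel] at this

lemma X_pow_dvd_distinctSeries_sub_prod (r : ℕ) {N m : ℕ} (hm : N ≤ m) :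
    (X : ℤ⟦X⟧) ^ N ∣ distinctSeries r -
      ∏ i ∈ range m, (if r ∣ i + 1 then 1 else 1 + (X : ℤ⟦X⟧) ^ (i + 1)) := by
  refine X_pow_dvd_sub_prod_of_hasProd (hasProd_mk_Qr ℤ r) (fun i hi => ?_) hm
  split_ifs
  · simp
  · rw [add_sub_cancel_left]; exact pow_dvd_pow _ (by omega)

/-- Truncation of integral power series: reduction modulo `X ^ N`. -/
noncomputable abbrev modXPow (N : ℕ) : ℤ⟦X⟧ →+* ℤ⟦X⟧ ⧸ Ideal.span {(X : ℤ⟦X⟧) ^ N} :=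
  Ideal.Quotient.mk _

lemma modXPow_eq_iff {N : ℕ} {f g : ℤ⟦X⟧} : modXPow N f = modXPow N g ↔ X ^ N ∣ f - g := by
  rw [Ideal.Quotient.eq, Ideal.mem_span_singleton]

lemma modXPow_X_pow (N : ℕ) : modXPow N X ^ N = 0 := by
  rw [← map_pow, ← map_zero (modXPow N), modXPow_eq_iff, sub_zero]

lemma coeff_eq_of_modXPow_eq {N n : ℕ} {f g : ℤ⟦X⟧} (h : modXPow N f = modXPow N g)
    (hn : n < N) : coeff n f = coeff n g := by
  rw [modXPow_eq_iff, X_pow_dvd_iff] at h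
  have := h n hn
  rwa [map_sub, sub_eq_zero] at this

lemma eq_of_modXPow_eq {f g : ℤ⟦X⟧} (h : ∀ N, modXPow N f = modXPow N g) : f = g :=
  PowerSeries.ext fun n => coeff_eq_of_modXPow_eq (h (n + 1)) n.lt_succ_self

lemma modXPow_distinctSeries (r : ℕ) {N m : ℕ} (hm : N ≤ m) :
    modXPow N (distinctSeries r) =
      ∏ i ∈ range m, (if r ∣ i + 1 then 1 else 1 + modXPow N X ^ (i + 1)) := by
  rw [modXPow_eq_iff.2 (X_pow_dvd_distinctSeries_sub_prod r hm), map_prod]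
  refine prod_congr rfl fun i _ => ?_
  split_ifs <;> simp

lemma modXPow_distinctSeries_zero {N m : ℕ} (hm : N ≤ m) :
    modXPow N (distinctSeries 0) = ∏ i ∈ range m, (1 + modXPow N X ^ (i + 1)) := by
  rw [modXPow_distinctSeries 0 hm]
  exact prod_congr rfl fun i _ => if_neg (by simp)

lemma modXPow_expand_distinctSeries {r : ℕ} (hr : r ≠ 0) {N m : ℕ} (hm : N ≤ m) :
    modXPow N (expand r hr (distinctSeries 0)) =
      ∏ i ∈ range m, (1 + (modXPow N X ^ r) ^ (i + 1)) := by
  obtain ⟨g, hg⟩ := X_pow_dvd_distinctSeries_sub_prod 0 hm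
  have h1 := congrArg (expand r hr) hg
  simp only [map_sub, map_mul, map_pow, map_prod, expand_X, zero_dvd_iff, Nat.add_eq_zero_iff,
    one_ne_zero, and_false, if_false, map_add, map_one] at h1
  have h2 : modXPow N (expand r hr (distinctSeries 0)) =
      modXPow N (∏ i ∈ range m, (1 + ((X : ℤ⟦X⟧) ^ r) ^ (i + 1))) := by
    rw [modXPow_eq_iff, h1, ← pow_mul]
    exact (pow_dvd_pow _ (Nat.le_mul_of_pos_left N (Nat.pos_of_ne_zero hr))).mul_right _
  rw [h2]
  simp

theorem distinctSeries_mul_expand {r : ℕ} (hr : r ≠ 0) :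
    distinctSeries r * expand r hr (distinctSeries 0) = distinctSeries 0 := by
  refine eq_of_modXPow_eq fun N => ?_
  have hN : N ≤ r * N := Nat.le_mul_of_pos_left N (Nat.pos_of_ne_zero hr)
  rw [map_mul, modXPow_distinctSeries r hN, modXPow_expand_distinctSeries hr le_rfl,
    modXPow_distinctSeries_zero hN]
  simp only [← pow_mul]
  rw [← prod_range_mul_ite_dvd (fun i => 1 + modXPow N X ^ i) hr, ← prod_mul_distrib]
  exact prod_congr rfl fun i _ => by split_ifs <;> simp

/-- The partial sum over `|j| ≤ K` of the theta series `∑ (-1) ^ j X ^ (r j ^ 2)`. -/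
noncomputable def thetaPartial (r K : ℕ) : ℤ⟦X⟧ :=
  1 + 2 * ∑ j ∈ Icc 1 K, (-1) ^ j * X ^ (r * j ^ 2)

lemma thetaTerm_self {R : Type*} [CommRing R] (a : R) (j : ℤ) :
    thetaTerm a a j = a ^ (j.natAbs ^ 2) := by
  rw [thetaTerm, ← pow_add]
  congr 1
  have h1 := two_mul_triangle j
  have h2 := two_mul_triangle (-j)
  zify
  rw [sq_abs]
  linarith

lemma sum_range_thetaTerm_self {R : Type*} [CommRing R] (a : R) (K : ℕ) :
    ∑ k ∈ range (2 * K + 1), thetaTerm a a ((k : ℤ) - K) =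
      1 + 2 * ∑ j ∈ Icc 1 K, a ^ (j ^ 2) := by
  simp only [thetaTerm_self]
  induction K with
  | zero => simp
  | succ K ih =>
    rw [mul_add_one, sum_range_succ, sum_range_succ', sum_Icc_succ_top (by omega), mul_add,
      ← add_assoc, ← ih]
    have h1 : ∀ k : ℕ, ((k + 1 : ℕ) : ℤ) - (K + 1 : ℕ) = (k : ℤ) - K := fun k => by
      push_cast; ring
    simp only [h1]
    have h2 : (((2 * K + 1 : ℕ) : ℤ) - K).natAbs = K + 1 := by omega
    have h3 : (((0 : ℕ) : ℤ) - (K + 1 : ℕ)).natAbs = K + 1 := by omega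
    rw [h2, h3]
    ring

/-- Since `j` and `j ^ 2` have the same parity, the alternating theta series is the case `a = b = -X
^ r` of `thetaTerm`. -/
lemma neg_one_pow_mul_pow_sq {R : Type*} [CommRing R] (x : R) (r j : ℕ) :
    (-1) ^ j * x ^ (r * j ^ 2) = (-x ^ r) ^ (j ^ 2) := by
  rw [neg_pow (x ^ r), ← pow_mul]
  congr 1
  rcases Nat.even_or_odd j with h | h
  · rw [h.neg_one_pow, (h.pow_of_ne_zero two_ne_zero).neg_one_pow]
  · rw [h.neg_one_pow, h.pow.neg_one_pow]

lemma modXPow_thetaPartial (N r K : ℕ) : modXPow N (thetaPartial r K) =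
    ∑ k ∈ range (2 * K + 1), thetaTerm (-modXPow N X ^ r) (-modXPow N X ^ r) ((k : ℤ) - K) := by
  rw [sum_range_thetaTerm_self, thetaPartial]
  simp only [map_add, map_one, map_mul, map_sum, map_pow, map_neg, map_ofNat]
  congr 2
  refine sum_congr rfl fun j _ => ?_
  exact neg_one_pow_mul_pow_sq _ r j

lemma modXPow_distinctSeries_mul_thetaPartial {r : ℕ} (hr : r ≠ 0) {N K : ℕ} (hK : N ≤ K) :
    modXPow N (distinctSeries 0 * thetaPartial r K) =
      (∏ i ∈ range (r * K), (if r ∣ i + 1 then 1 else 1 + modXPow N X ^ (i + 1))) *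
        ∏ i ∈ range K, (1 - modXPow N X ^ (r * (i + 1))) := by
  have hN : K ≤ r * K := Nat.le_mul_of_pos_left K (Nat.pos_of_ne_zero hr)
  have hx : (modXPow N X ^ r) ^ N = 0 := by
    rw [← pow_mul, mul_comm, pow_mul, modXPow_X_pow, zero_pow hr]
  rw [← distinctSeries_mul_expand hr, mul_assoc, map_mul, map_mul,
    modXPow_distinctSeries r (hK.trans hN),
    modXPow_expand_distinctSeries hr (show N ≤ 2 * K by omega), modXPow_thetaPartial,
    prod_one_add_mul_sum_thetaTerm hx hK]
  simp only [← pow_mul]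

lemma map_thetaTerm {R S : Type*} [CommRing R] [CommRing S] (f : R →+* S) (a b : R) (j : ℤ) :
    f (thetaTerm a b j) = thetaTerm (f a) (f b) j := by
  simp [thetaTerm]

/-- The exponents `j (3 j - 1) / 2` of the pentagonal number theorem. -/
def pentagonalExponent (j : ℤ) : ℕ := triangle j + 2 * triangle (-j)

lemma two_mul_pentagonalExponent (j : ℤ) : 2 * (pentagonalExponent j : ℤ) = j * (3 * j - 1) := by
  have h1 := two_mul_triangle j
  have h2 := two_mul_triangle (-j)
  rw [pentagonalExponent]
  push_cast
  linarith

lemma pentagonalExponent_injective : Function.Injective pentagonalExponent := by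
  intro i j h
  have h1 := two_mul_pentagonalExponent i
  have h2 := two_mul_pentagonalExponent j
  rw [h] at h1
  have h3 : (i - j) * (3 * (i + j) - 1) = 0 := by linarith
  rcases mul_eq_zero.1 h3 with h | h <;> omega

lemma natAbs_le_pentagonalExponent (j : ℤ) : j.natAbs ≤ pentagonalExponent j := by
  have h := two_mul_pentagonalExponent j
  rcases lt_trichotomy j 0 with hj | rfl | hj
  · have : -j ≤ pentagonalExponent j := by nlinarith
    omega
  · simp
  · have : j ≤ pentagonalExponent j := by nlinarith
    omega

lemma thetaTerm_pentagonal (ε η : ℤ) (j : ℤ) :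
    thetaTerm (C ε * X : ℤ⟦X⟧) (C η * X ^ 2) j =
      C (thetaTerm ε η j) * X ^ pentagonalExponent j := by
  simp only [thetaTerm, pentagonalExponent, map_mul, map_pow]
  ring

/-- The integer whose pentagonal exponent is the `m`th generalized pentagonal number. -/
def pentagonalIndex (m : ℕ) : ℤ := if Even m then -((m / 2 : ℕ) : ℤ) else (m / 2 : ℕ) + 1

lemma two_mul_T (n : ℕ) : 2 * T n = n * (n + 1) :=
  Nat.mul_div_cancel' (Nat.even_mul_succ_self n).two_dvd

lemma T_eq_triangle (n : ℕ) : T n = triangle n := by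
  have h1 := two_mul_T n
  have h2 := two_mul_triangle n
  zify at h1 ⊢
  linarith

lemma triangle_neg_sub_one (j : ℤ) : triangle (-j - 1) = triangle j := by
  have h1 := two_mul_triangle j
  have h2 := two_mul_triangle (-j - 1)
  zify
  linarith

lemma G_eq_pentagonalExponent (m : ℕ) : G m = pentagonalExponent (pentagonalIndex m) := by
  have h1 := two_mul_pentagonalExponent (pentagonalIndex m)
  have h2 := two_mul_T m
  have h3 := two_mul_T (m / 2)
  rw [G]
  suffices h : pentagonalExponent (pentagonalIndex m) + T (m / 2) = T m by omega
  rcases Nat.even_or_odd' m with ⟨i, rfl | rfl⟩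
  · have e : 2 * i / 2 = i := by omega
    rw [pentagonalIndex, if_pos (by simp), e] at h1 ⊢
    rw [e] at h3
    zify at h2 h3 ⊢
    linarith
  · have e : (2 * i + 1) / 2 = i := by omega
    rw [pentagonalIndex, if_neg (by simp), e] at h1 ⊢
    rw [e] at h3
    zify at h2 h3 ⊢
    linarith

lemma pentagonalIndex_surjective : Function.Surjective pentagonalIndex := by
  intro j
  rcases le_or_gt j 0 with h | h
  · refine ⟨2 * j.natAbs, ?_⟩
    rw [pentagonalIndex, if_pos (by simp)]
    omega
  · refine ⟨2 * (j.natAbs - 1) + 1, ?_⟩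
    rw [pentagonalIndex, if_neg (by simp)]
    omega

lemma coeff_sum_thetaTerm_pentagonal (ε η : ℤ) {m n K : ℕ} (hK : n ≤ K)
    (hm : (∃ i, n = G i) → n = G m) :
    coeff n (∑ k ∈ range (2 * K + 1), thetaTerm (C ε * X : ℤ⟦X⟧) (C η * X ^ 2) ((k : ℤ) - K)) =
      thetaTerm ε η (pentagonalIndex m) * if n = G m then 1 else 0 := by
  simp only [map_sum, thetaTerm_pentagonal, coeff_C_mul_X_pow]
  split_ifs with h
  · rw [G_eq_pentagonalExponent] at h
    -- The index has absolute value at most its exponent `n ≤ K`, so it lies in the summation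
    -- window; injectivity of the exponents makes it the only contributor.
    have hle := natAbs_le_pentagonalExponent (pentagonalIndex m)
    rw [sum_eq_single (K + pentagonalIndex m).toNat]
    · have e : (((K + pentagonalIndex m).toNat : ℕ) : ℤ) - K = pentagonalIndex m := by omega
      rw [e, if_pos h, mul_one]
    · intro k _ hk
      refine if_neg fun h' => hk ?_
      have := pentagonalExponent_injective (h.symm.trans h')
      omega
    · intro hk
      rw [mem_range] at hk
      omega
  · rw [mul_zero]
    refine sum_eq_zero fun k _ => if_neg fun h' => h (hm ?_)
    obtain ⟨i, hi⟩ := pentagonalIndex_surjective ((k : ℤ) - K)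
    exact ⟨i, by rw [G_eq_pentagonalExponent, hi, h']⟩

lemma thetaTerm_neg_one_neg_one (m : ℕ) :
    thetaTerm (-1 : ℤ) (-1) (pentagonalIndex m) = (-1) ^ T m := by
  rw [thetaTerm_self]
  have h2 := two_mul_T m
  refine neg_one_pow_congr ?_
  rw [Nat.even_pow' two_ne_zero]
  rcases Nat.even_or_odd' m with ⟨i, rfl | rfl⟩
  · have e : T (2 * i) = i * (2 * i + 1) := by linarith
    rw [pentagonalIndex, if_pos (by simp), e]
    simp [Nat.even_mul]
  · have e : T (2 * i + 1) = (2 * i + 1) * (i + 1) := by linarith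
    rw [pentagonalIndex, if_neg (by simp), e, show ((((2 * i + 1) / 2 : ℕ) : ℤ) + 1).natAbs = i + 1
      by omega]
    simp [Nat.even_mul]

/-- For `i = m / 2` the index is `-i` or `i + 1`, and the triangular numbers of `i` and `-i - 1`
coincide. -/
lemma thetaTerm_one_neg_one (m : ℕ) :
    thetaTerm (1 : ℤ) (-1) (pentagonalIndex m) = (-1) ^ T (m / 2) := by
  rw [thetaTerm, one_pow, one_mul, T_eq_triangle, pentagonalIndex]
  split_ifs
  · rw [neg_neg]
  · rw [neg_add, ← sub_eq_add_neg, triangle_neg_sub_one]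

lemma thetaTerm_one_one (j : ℤ) : thetaTerm (1 : ℤ) 1 j = 1 := by simp [thetaTerm]

lemma coeff_distinctSeries_mul_thetaPartial {r : ℕ} (hr : r ≠ 0) (ε η : ℤ)
    (h : ∀ N K, N ≤ K →
      (∏ i ∈ range (r * K), (if r ∣ i + 1 then 1 else 1 + modXPow N X ^ (i + 1))) *
        ∏ i ∈ range K, (1 - modXPow N X ^ (r * (i + 1))) =
      ∑ k ∈ range (2 * K + 1), thetaTerm (modXPow N (C ε * X)) (modXPow N (C η * X ^ 2))
        ((k : ℤ) - K))
    {m n K : ℕ} (hK : n < K) (hm : (∃ i, n = G i) → n = G m) :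
    coeff n (distinctSeries 0 * thetaPartial r K) =
      thetaTerm ε η (pentagonalIndex m) * if n = G m then 1 else 0 := by
  rw [← coeff_sum_thetaTerm_pentagonal ε η hK.le hm]
  refine coeff_eq_of_modXPow_eq (N := n + 1) ?_ n.lt_succ_self
  rw [modXPow_distinctSeries_mul_thetaPartial hr hK, h _ _ hK, map_sum]
  simp only [map_thetaTerm]

/-- The generating function of `Mo k`. -/
noncomputable def moSeries (k : ℕ) : ℤ⟦X⟧ := PowerSeries.mk fun n => (Mo k n : ℤ)

lemma coeff_X_pow_mul_distinctSeries (e n : ℕ) :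
    coeff n ((X : ℤ⟦X⟧) ^ e * distinctSeries 0) = Q ((n : ℤ) - e) := by
  rw [coeff_X_pow_mul', distinctSeries, coeff_mk, Qr_zero]
  split_ifs with h
  · rw [Nat.cast_sub h]
  · rw [Q, if_neg (by omega)]; rfl

lemma moSeries_add_succ (k : ℕ) :
    moSeries k + moSeries (k + 1) = X ^ ((k + 1) ^ 2) * distinctSeries 0 := by
  ext n
  rw [coeff_X_pow_mul_distinctSeries, map_add, moSeries, moSeries, coeff_mk, coeff_mk,
    ← Nat.cast_add, Mo_add_Mo_succ]
  push_cast
  rfl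

lemma coeff_distinctSeries_mul_expand {r : ℕ} (hr : r ≠ 0) (f : ℤ⟦X⟧) (n : ℕ) :
    coeff n (distinctSeries r * expand r hr f) =
      ∑ j ∈ range (n / r + 1), coeff j f * (Qr r (n - r * j) : ℤ) := by
  rw [mul_comm, coeff_mul, Nat.sum_antidiagonal_eq_sum_range_succ
    (fun i j => coeff i (expand r hr f) * coeff j (distinctSeries r))]
  symm
  refine sum_of_injOn (r * ·) (fun a _ b _ h => Nat.eq_of_mul_eq_mul_left
    (Nat.pos_of_ne_zero hr) h) ?_ ?_ ?_
  · intro j hj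
    simp only [coe_range, Set.mem_Iio, Nat.lt_succ_iff] at hj ⊢
    exact (Nat.mul_le_mul_left r hj).trans (Nat.mul_div_le n r)
  · intro i hi hi'
    rw [coeff_expand_of_not_dvd, zero_mul]
    rintro ⟨j, rfl⟩
    refine hi' ⟨j, ?_, rfl⟩
    rw [mem_range, Nat.lt_succ_iff] at hi
    simp only [coe_range, Set.mem_Iio, Nat.lt_succ_iff]
    rwa [Nat.le_div_iff_mul_le (Nat.pos_of_ne_zero hr), mul_comm]
  · intro j _
    rw [coeff_expand_mul, distinctSeries, coeff_mk]

/-- Both sides are compared through their difference `D`. The recurrence for `moSeries`, transported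
by `X ↦ X ^ r` and multiplied by `distinctSeries r`, matches the term added to `thetaPartial` and
yields `D (k + 1) = -D k`. -/
theorem neg_one_pow_mul_coeff_thetaPartial {r : ℕ} (hr : r ≠ 0) {n : ℕ} {c : ℤ}
    (hc : ∀ K, n < K → coeff n (distinctSeries 0 * thetaPartial r K) = c) (k : ℕ) :
    (-1) ^ k * (coeff n (distinctSeries 0 * thetaPartial r k) - c) =
      2 * coeff n (distinctSeries r * expand r hr (moSeries k)) := by
  set D : ℕ → ℤ := fun k => (-1) ^ k * (coeff n (distinctSeries 0 * thetaPartial r k) - c) -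
    2 * coeff n (distinctSeries r * expand r hr (moSeries k)) with hD
  have step : ∀ k, D (k + 1) = -D k := by
    intro k
    have h1 : thetaPartial r (k + 1) =
        thetaPartial r k + C (2 * (-1) ^ (k + 1)) * X ^ (r * (k + 1) ^ 2) := by
      rw [thetaPartial, thetaPartial, sum_Icc_succ_top (by omega)]
      simp only [map_mul, map_pow, map_neg, map_one, map_ofNat]
      ring
    have h2 : distinctSeries r * expand r hr (moSeries k) +
        distinctSeries r * expand r hr (moSeries (k + 1)) =
        distinctSeries 0 * X ^ (r * (k + 1) ^ 2) := by
      rw [← mul_add, ← map_add, moSeries_add_succ, map_mul, map_pow, expand_X, ← pow_mul,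
        mul_left_comm, distinctSeries_mul_expand, mul_comm]
    have h3 := congrArg (coeff n) h2
    rw [map_add] at h3
    have h4 : coeff n (distinctSeries 0 * thetaPartial r (k + 1)) =
        coeff n (distinctSeries 0 * thetaPartial r k) +
          2 * (-1) ^ (k + 1) * coeff n (distinctSeries 0 * X ^ (r * (k + 1) ^ 2)) := by
      rw [h1, mul_add, map_add, mul_left_comm, coeff_C_mul]
    have h5 : ((-1 : ℤ) ^ k) ^ 2 = 1 := by rw [← pow_mul, mul_comm, pow_mul]; simp
    simp only [hD]
    rw [h4, ← h3, pow_succ]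
    linear_combination (2 * (coeff n (distinctSeries r * expand r hr (moSeries k)) +
      coeff n (distinctSeries r * expand r hr (moSeries (k + 1))))) * h5
  -- Beyond `n` the coefficient of the partial theta product equals its limit `c`, and every `Mo`
  -- that occurs vanishes.
  have hzero : D (k + (n + 1)) = 0 := by
    simp only [hD]
    rw [hc _ (by omega), sub_self, mul_zero, zero_sub, coeff_distinctSeries_mul_expand,
      sum_eq_zero, mul_zero, neg_zero]
    intro j hj
    rw [mem_range, Nat.lt_succ_iff] at hj
    have := hj.trans (Nat.div_le_self n r)
    rw [moSeries, coeff_mk, Mo_eq_zero_of_lt (by omega), Nat.cast_zero, zero_mul]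
  have habs : ∀ t, D (k + t) = 0 → D k = 0 := by
    intro t
    induction t with
    | zero => exact id
    | succ t ih => intro h; exact ih (by rwa [← add_assoc, step, neg_eq_zero] at h)
  exact sub_eq_zero.1 (habs _ hzero)

lemma coeff_distinctSeries_mul_thetaPartial_eq_sum (r k n : ℕ) :
    coeff n (distinctSeries 0 * thetaPartial r k) = (Q (n : ℤ) : ℤ) +
      2 * ∑ j ∈ Icc 1 k, (-1 : ℤ) ^ j * (Q ((n : ℤ) - r * (j : ℤ) ^ 2) : ℤ) := by
  have h : distinctSeries 0 * thetaPartial r k = X ^ 0 * distinctSeries 0 +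
      C 2 * ∑ j ∈ Icc 1 k, C ((-1) ^ j) * (X ^ (r * j ^ 2) * distinctSeries 0) := by
    rw [thetaPartial]
    simp only [map_pow, map_neg, map_one, map_ofNat, ← mul_assoc, ← sum_mul]
    ring
  rw [h, map_add, coeff_C_mul, map_sum, coeff_X_pow_mul_distinctSeries]
  simp only [coeff_C_mul, coeff_X_pow_mul_distinctSeries]
  push_cast
  rw [sub_zero]

/-- Brings part a) under the uniform statement: for `r = 1` the convolution collapses to its term `j
= n`. -/
lemma Qr_one (n : ℕ) : Qr 1 n = if n = 0 then 1 else 0 := by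
  unfold Qr
  split_ifs with h
  · subst h
    rfl
  · rw [card_eq_zero, filter_eq_empty_iff]
    intro p _ hp
    have h0 : p.parts = 0 := Multiset.eq_zero_of_forall_notMem fun i hi => hp i hi (one_dvd i)
    have := p.parts_sum
    rw [h0, Multiset.sum_zero] at this
    exact h this.symm

/-- The three truncated identities in a uniform way, given the product formula for the full
theta series. -/
theorem truncated_theta {r : ℕ} (hr : r ≠ 0) (ε η : ℤ)
    (h : ∀ N K, N ≤ K →
      (∏ i ∈ range (r * K), (if r ∣ i + 1 then 1 else 1 + modXPow N X ^ (i + 1))) *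
        ∏ i ∈ range K, (1 - modXPow N X ^ (r * (i + 1))) =
      ∑ k ∈ range (2 * K + 1), thetaTerm (modXPow N (C ε * X)) (modXPow N (C η * X ^ 2))
        ((k : ℤ) - K))
    {m n : ℕ} (hm : (∃ i, n = G i) → n = G m) (k : ℕ) :
    (-1 : ℤ) ^ k * ((Q (n : ℤ) : ℤ) +
        2 * ∑ j ∈ Icc 1 k, (-1 : ℤ) ^ j * (Q ((n : ℤ) - r * (j : ℤ) ^ 2) : ℤ) -
        thetaTerm ε η (pentagonalIndex m) * (if n = G m then 1 else 0)) =
      2 * ∑ j ∈ range (n / r + 1), (Mo k j : ℤ) * (Qr r (n - r * j) : ℤ) := by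
  have := neg_one_pow_mul_coeff_thetaPartial hr
    (fun K hK => coeff_distinctSeries_mul_thetaPartial hr ε η h hK hm) k
  rw [coeff_distinctSeries_mul_thetaPartial_eq_sum, coeff_distinctSeries_mul_expand] at this
  simpa only [moSeries, coeff_mk] using this

end GeneratingFunctions

end TruncTheta

theorem corollary3p2 (m n k : ℕ) (hk : 1 ≤ k)
    (hm : (∃ i : ℕ, n = TruncTheta.G i) → n = TruncTheta.G m) :
    ((-1 : ℤ) ^ k * ((TruncTheta.Q (n : ℤ) : ℤ)
        + 2 * ∑ j ∈ Finset.Icc 1 k, (-1 : ℤ) ^ j * (TruncTheta.Q ((n : ℤ) - (j : ℤ) ^ 2) : ℤ)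
        - (-1 : ℤ) ^ TruncTheta.T m * (if n = TruncTheta.G m then 1 else 0))
      = 2 * (TruncTheta.Mo k n : ℤ)) ∧
    ((-1 : ℤ) ^ k * ((TruncTheta.Q (n : ℤ) : ℤ)
        + 2 * ∑ j ∈ Finset.Icc 1 k, (-1 : ℤ) ^ j * (TruncTheta.Q ((n : ℤ) - 2 * (j : ℤ) ^ 2) : ℤ)
        - (-1 : ℤ) ^ TruncTheta.T (m / 2) * (if n = TruncTheta.G m then 1 else 0))
      = 2 * ∑ j ∈ Finset.range (n / 2 + 1),
          (TruncTheta.Mo k j : ℤ) * (TruncTheta.Qr 2 (n - 2 * j) : ℤ)) ∧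
    ((-1 : ℤ) ^ k * ((TruncTheta.Q (n : ℤ) : ℤ)
        + 2 * ∑ j ∈ Finset.Icc 1 k, (-1 : ℤ) ^ j * (TruncTheta.Q ((n : ℤ) - 3 * (j : ℤ) ^ 2) : ℤ)
        - (if n = TruncTheta.G m then 1 else 0))
      = 2 * ∑ j ∈ Finset.range (n / 3 + 1),
          (TruncTheta.Mo k j : ℤ) * (TruncTheta.Qr 3 (n - 3 * j) : ℤ)) := by
  refine ⟨?_, ?_, ?_⟩
  · have h := TruncTheta.truncated_theta one_ne_zero (-1) (-1) (fun N K hK => by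
      simpa using TruncTheta.prod_one_sub_eq_sum_thetaTerm (TruncTheta.modXPow_X_pow N) hK hK) hm k
    have hs : ∑ j ∈ Finset.range (n / 1 + 1),
        (TruncTheta.Mo k j : ℤ) * (TruncTheta.Qr 1 (n - 1 * j) : ℤ) = TruncTheta.Mo k n := by
      rw [Nat.div_one, Finset.sum_range_succ, Finset.sum_eq_zero]
      · simp [TruncTheta.Qr_one]
      · intro j hj
        rw [Finset.mem_range] at hj
        rw [TruncTheta.Qr_one, if_neg (by omega), Nat.cast_zero, mul_zero]
    rw [TruncTheta.thetaTerm_neg_one_neg_one, hs] at h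
    simpa only [Nat.cast_one, one_mul] using h
  · have h := TruncTheta.truncated_theta two_ne_zero 1 (-1) (fun N K hK => by
      simpa using TruncTheta.prod_coprime_two_mul_prod (TruncTheta.modXPow_X_pow N) hK) hm k
    rw [TruncTheta.thetaTerm_one_neg_one] at h
    exact_mod_cast h
  · have h := TruncTheta.truncated_theta three_ne_zero 1 1 (fun N K hK => by
      simpa using TruncTheta.prod_coprime_three_mul_prod (TruncTheta.modXPow_X_pow N) hK) hm k
    rw [TruncTheta.thetaTerm_one_one, one_mul] at h
    exact_mod_cast h
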